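/- Let $p$ be an odd prime and let $m,k$ be positive integers. Put $e=\gcd(m,k)$ and $s=m/e$, and suppose that $s$ is odd, $s\ge 3$, $k$ is even and $e$ is odd. Let $\pi$ be a primitive element of the finite field $\mathrm{GF}(p^m)$ (a generator of its multiplicative group), and let $h_1(x)$ and $h_2(x)$ be the minimal polynomials over $\mathrm{GF}(p)$ of $(-\pi)^{-1}$ and $\pi^{-(p^k+1)/2}$, respectively. Let $\mathcal C$ be the cyclic code over $\mathrm{GF}(p)$ of length $n=p^m-1$ with parity-check polynomial $h_1(x)h_2(x)$; that is, words $(c_0,\dots,c_{n-1})$ being identified with the classes of $c_0+c_1x+\cdots+c_{n-1}x^{n-1}$ in $\mathrm{GF}(p)[x]/(x^n-1)$, $\mathcal C$ is the ideal whose generator polynomial $g(x)$ (the monic generator of least degree) satisfies $g(x)h_1(x)h_2(x)=x^n-1$. Such a code exists and is unique. It is a three-weight cyclic code (its codewords have exactly three distinct nonzero Hamming weights) with length $p^m-1$, dimension $2m$ and minimum Hamming distance $$p^m-p^{m-1}-\frac{p-1}{2}\,p^{(m+e-2)/2}.$$ Moreover, its weight distribution is as follows, and no codeword has any other weight: - weight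 $0$ occurs $1$ time; - weight $p^m-p^{m-1}-\frac{p-1}{2}p^{(m+e-2)/2}$ occurs $(p^{m-e}+p^{(m-e)/2})(p^m-1)$ times; - weight $p^m-p^{m-1}$ occurs $(p^m-2p^{m-e}+1)(p^m-1)$ times; - weight $p^m-p^{m-1}+\frac{p-1}{2}p^{(m+e-2)/2}$ occurs $(p^{m-e}-p^{(m-e)/2})(p^m-1)$ times. -/

import Mathlib

open Polynomial

namespace CyclicCodes

/-- The polynomial `c₀ + c₁ X + ⋯ + cₙ₋₁ Xⁿ⁻¹` attached to a word of length `n`. -/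
noncomputable def wordPoly {F : Type*} [Field F] {n : ℕ} (c : Fin n → F) : F[X] :=
  ∑ i : Fin n, C (c i) * X ^ (i : ℕ)

/-- The residue ring `F[X]/(Xⁿ - 1)`. -/
abbrev ResidueRing (F : Type*) [Field F] (n : ℕ) : Type _ :=
  F[X] ⧸ Ideal.span {(X ^ n - 1 : F[X])}

/-- The word `c` viewed as an element of `F[X]/(Xⁿ - 1)`. -/
noncomputable def wordClass {F : Type*} [Field F] {n : ℕ} (c : Fin n → F) : ResidueRing F n :=
  Ideal.Quotient.mk (Ideal.span {(X ^ n - 1 : F[X])}) (wordPoly c)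

/-- A linear code of length `n` over `F` is a subspace of `Fⁿ`. It is cyclic if it contains
`(cₙ₋₁, c₀, …, cₙ₋₂)` whenever it contains `(c₀, c₁, …, cₙ₋₁)`. -/
def IsCyclicCode {F : Type*} [Field F] {n : ℕ} (K : Submodule F (Fin n → F)) : Prop :=
  ∀ c ∈ K, (fun i => c ((finRotate n).symm i)) ∈ K

/-- Under the identification of words with residue classes, `K` is the ideal generated by
the class of `g`. -/
def IsGeneratedBy {F : Type*} [Field F] {n : ℕ} (K : Submodule F (Fin n → F)) (g : F[X]) : Prop :=
  ∀ c : Fin n → F, c ∈ K ↔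
    wordClass c ∈ Ideal.span {Ideal.Quotient.mk (Ideal.span {(X ^ n - 1 : F[X])}) g}

/-- The generator polynomial: monic, generates `K`, of least degree. -/
def IsGeneratorPolynomial {F : Type*} [Field F] {n : ℕ} (K : Submodule F (Fin n → F))
    (g : F[X]) : Prop :=
  g.Monic ∧ IsGeneratedBy K g ∧
    ∀ g' : F[X], g'.Monic → IsGeneratedBy K g' → g.natDegree ≤ g'.natDegree

/-- `h` is the parity-check polynomial `(Xⁿ - 1)/g` of `K`, with `g` the generator polynomial. -/
def IsParityCheckPolynomial {F : Type*} [Field F] {n : ℕ} (K : Submodule F (Fin n → F))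
    (h : F[X]) : Prop :=
  ∃ g : F[X], IsGeneratorPolynomial K g ∧ g * h = X ^ n - 1

/-- `K` has minimum Hamming distance `d`. -/
def HasMinDistance {F : Type*} [Field F] [DecidableEq F] {n : ℕ} (K : Submodule F (Fin n → F))
    (d : ℕ) : Prop :=
  IsLeast {w : ℕ | ∃ x ∈ K, ∃ y ∈ K, x ≠ y ∧ hammingDist x y = w} d

/-- `K`, a code of length `n`, is an `[n, ℓ, d]` linear code. -/
def HasParameters {F : Type*} [Field F] [DecidableEq F] {n : ℕ} (K : Submodule F (Fin n → F))
    (ℓ d : ℕ) : Prop :=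
  Module.finrank F K = ℓ ∧ HasMinDistance K d

/-- The number `A_w` of codewords of Hamming weight `w`. -/
noncomputable def weightCount {F : Type*} [Field F] [DecidableEq F] {n : ℕ}
    (K : Submodule F (Fin n → F)) (w : ℕ) : ℕ :=
  {c : Fin n → F | c ∈ K ∧ hammingNorm c = w}.ncard

/-- The codewords of `K` take exactly three nonzero Hamming weights. -/
def IsThreeWeight {F : Type*} [Field F] [DecidableEq F] {n : ℕ}
    (K : Submodule F (Fin n → F)) : Prop :=
  {w : ℕ | w ≠ 0 ∧ ∃ c ∈ K, hammingNorm c = w}.ncard = 3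

end CyclicCodes

/-! Write E = GF(p^m), d = (p^k+1)/2, σ for the p^k-power Frobenius and χ for the quadratic
character of E. The codewords are the trace words with entries Tr(a(-π)^i + bπ^{di}). Since π is a
nonsquare, (-π)^i = χ(x)x at x = π^i, so the weight is governed by the number of x ≠ 0 with
Tr(aχ(x)x + bx^d) = 0. Let x run over y² and ly², with l a nonresidue of GF(p): it stays a nonsquare
in E because m is odd, and l^d = l because k is even. Twice the number of zeros then becomes the sum
of the zero counts of the two quadratic forms Tr(±ay² + byσ(y))
(`two_mul_card_traceFunctional_zeros`).

The radical of each form has 1, p^e or p^{2e} elements (`card_polar_radical`). As m and e are odd,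
only the size p^e makes the zero count differ from p^{m-1}, and then by ±(p-1)p^{(m+e-2)/2}. The
radicals for a and -a are never both nonzero (`polar_radical_eq_zero_or`), so at most one form
deviates, which leaves three weights. The zero counts need neither diagonalisation nor Gauss sums:
the first two moments of the values of the form lead to pX² + Y² = 4p^N, which a descent solves.

The three frequencies follow from their total and from the first two moments of the number of zeros
over all (a, b) (`card_of_moments`). Every weight being positive, the encoding is injective, and
comparing cardinalities identifies its image with the code. -/

namespace CyclicCodes

/-! ### The equation pX² + Y² = 4p^N -/

open Finset

/-- Descent: p divides Y and then X, so p² can be cancelled until the right side is 4. There 3·1² +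
1² = 4 is the one solution with X ≠ 0 up to sign, and the parity condition at p = 3 excludes it. -/
theorem eq_zero_of_mul_sq_add_sq_eq {p : ℕ} (hp : p.Prime) (hp2 : p ≠ 2) (j : ℕ) :
    ∀ X Y : ℤ, (p : ℤ) * X ^ 2 + Y ^ 2 = 4 * (p : ℤ) ^ (2 * j) → (p = 3 → Even X) → X = 0 := by
  have hpi : Prime (p : ℤ) := Nat.prime_iff_prime_int.mp hp
  have hp3 : 3 ≤ p := by have := hp.two_le; omega
  induction j with
  | zero =>
    intro X Y h h3
    by_contra hX
    have hX1 : 1 ≤ X ^ 2 := by have : 0 < X ^ 2 := by positivity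
                               omega
    have hp3' : (3 : ℤ) ≤ p := by exact_mod_cast hp3
    by_cases hq : p = 3
    · obtain ⟨c, rfl⟩ := h3 hq
      have : c ≠ 0 := by rintro rfl; simp at hX
      have : 0 < c ^ 2 := by positivity
      subst hq
      push_cast at h
      nlinarith [sq_nonneg Y]
    · have h4 : p ≠ 4 := by rintro rfl; revert hp; decide
      simp only [mul_zero, pow_zero, mul_one] at h
      have : (5 : ℤ) ≤ p := by exact_mod_cast (by omega : 5 ≤ p)
      nlinarith [sq_nonneg Y]
  | succ j ih =>
    intro X Y h h3
    have hY : (p : ℤ) ∣ Y := by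
      refine hpi.dvd_of_dvd_pow (n := 2) ?_
      exact ⟨4 * p ^ (2 * j + 1) - X ^ 2, by
        rw [show 2 * (j + 1) = 2 * j + 1 + 1 by ring, pow_succ _ (2 * j + 1)] at h; linear_combination h⟩
    obtain ⟨Y', rfl⟩ := hY
    have hp0 : (p : ℤ) ≠ 0 := hpi.ne_zero
    have h' : X ^ 2 + p * Y' ^ 2 = 4 * p * p ^ (2 * j) := by
      apply mul_left_cancel₀ hp0
      rw [show 2 * (j + 1) = 2 * j + 1 + 1 by ring, pow_succ, pow_succ] at h
      linear_combination h
    have hX : (p : ℤ) ∣ X := by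
      refine hpi.dvd_of_dvd_pow (n := 2) ?_
      exact ⟨4 * p ^ (2 * j) - Y' ^ 2, by linear_combination h'⟩
    obtain ⟨X', rfl⟩ := hX
    rw [ih X' Y' ?_ ?_, mul_zero]
    · apply mul_left_cancel₀ hp0
      linear_combination h'
    · intro h3'
      have := h3 h3'
      rw [Int.even_mul] at this
      subst h3'
      rcases this with h | h
      · exact absurd h (by decide)
      · exact h

theorem sq_eq_of_mul_sq_add_sq_eq {p : ℕ} (hp : p.Prime) (hp2 : p ≠ 2) (j : ℕ) (X Y : ℤ)
    (h : (p : ℤ) * X ^ 2 + Y ^ 2 = 4 * (p : ℤ) ^ (2 * j + 1)) (h3 : p = 3 → Even X) :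
    X = 2 * p ^ j ∨ X = - (2 * p ^ j) := by
  have hpi : Prime (p : ℤ) := Nat.prime_iff_prime_int.mp hp
  have hp0 : (p : ℤ) ≠ 0 := hpi.ne_zero
  have hY : (p : ℤ) ∣ Y := by
    refine hpi.dvd_of_dvd_pow (n := 2) ?_
    exact ⟨4 * p ^ (2 * j) - X ^ 2, by rw [pow_succ _ (2 * j)] at h; linear_combination h⟩
  obtain ⟨Y', rfl⟩ := hY
  have h' : p * Y' ^ 2 + X ^ 2 = 4 * p ^ (2 * j) := by
    apply mul_left_cancel₀ hp0
    rw [pow_succ] at h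
    linear_combination h
  -- Cancelling p exchanges the roles of the two unknowns and leaves an even exponent; at p = 3 the
  -- evenness of X passes to Y'.
  have hY' : Y' = 0 := by
    refine eq_zero_of_mul_sq_add_sq_eq hp hp2 j Y' X h' fun hp3 => ?_
    have hX := h3 hp3
    subst hp3
    have : Even (((3 : ℕ) : ℤ) * Y' ^ 2 + X ^ 2) := by
      rw [h']; exact Even.mul_right (by decide) _
    rw [Int.even_add, Int.even_mul, Int.even_pow' two_ne_zero, Int.even_pow' two_ne_zero] at this
    rcases this.2 hX with h | h
    · exact absurd h (by decide)
    · exact h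
  subst hY'
  apply sq_eq_sq_iff_eq_or_eq_neg.mp
  rw [mul_pow, ← pow_mul, mul_comm j]
  linear_combination h'

/-! ### Common zeros of linear functionals -/

section Functional

variable {p : ℕ} [Fact p.Prime] {V : Type*} [AddCommGroup V] [Module (ZMod p) V] [Fintype V]

open Classical in
theorem card_filter_functional_eq_zero (f : V →ₗ[ZMod p] ZMod p) (hf : f ≠ 0) :
    p * #{v | f v = 0} = Fintype.card V := by
  have hs : Function.Surjective f := LinearMap.surjective hf
  have h := f.toAddMonoidHom.ker.card_eq_card_quotient_mul_card_addSubgroup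
  rw [Nat.card_congr (QuotientAddGroup.quotientKerEquivOfSurjective f.toAddMonoidHom hs).toEquiv,
    Nat.card_zmod, Nat.card_eq_fintype_card] at h
  rw [h]
  congr 1
  rw [Nat.card_eq_fintype_card, Fintype.card_subtype]
  congr 1
  ext v
  simp

open Classical in
theorem card_filter_two_functionals (f g : V →ₗ[ZMod p] ZMod p) (hf : f ≠ 0)
    (hg : ∀ c : ZMod p, g ≠ c • f) :
    p ^ 2 * #{v | f v = 0 ∧ g v = 0} = Fintype.card V := by
  rw [← card_filter_functional_eq_zero f hf, sq, mul_assoc]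
  congr 1
  have hne : g.domRestrict (LinearMap.ker f) ≠ 0 := by
    intro h0
    obtain ⟨w, hw⟩ := LinearMap.surjective hf 1
    refine hg (g w) (LinearMap.ext fun v => ?_)
    have := LinearMap.congr_fun h0 ⟨v - f v • w, by simp [hw]⟩
    simp only [LinearMap.domRestrict_apply, map_sub, map_smul, smul_eq_mul,
      LinearMap.zero_apply] at this
    simp only [LinearMap.smul_apply, smul_eq_mul]
    linear_combination this
  have h := card_filter_functional_eq_zero _ hne
  rw [Fintype.card_subtype] at h
  simp only [LinearMap.mem_ker] at h
  rw [← h]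
  congr 1
  symm
  refine Finset.card_bij (fun v _ => (v : V)) ?_ ?_ ?_
  · rintro ⟨v, hv⟩ h; simpa using ⟨hv, (mem_filter.mp h).2⟩
  · intro a _ b _ h; exact Subtype.ext h
  · intro v hv; simp at hv; exact ⟨⟨v, hv.1⟩, mem_filter.mpr ⟨mem_univ _, hv.2⟩, rfl⟩

end Functional

/-! ### Zeros of a quadratic form from two moments -/

section ZeroCount

variable {p : ℕ} [Fact p.Prime] {V : Type*} [AddCommGroup V] [Module (ZMod p) V] [Fintype V]

-- The number N(t) of solutions of B(x,x) = t depends, for t ≠ 0, only on the square class of t, so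
-- N is determined by N(0), S = N(1) + N(l) and Y = N(1) - N(l). The sum of N is the size of V, and
-- the sum of N² is fixed by the size of the radical; eliminating N(0) gives the equation in X and
-- Y.
open Classical in
theorem exists_sq_add_sq_of_bilin (hp2 : p ≠ 2) (B : V →ₗ[ZMod p] V →ₗ[ZMod p] ZMod p) {m r : ℕ}
    (hm : 0 < m) (hV : Fintype.card V = p ^ m)
    (hR : #{u : V | ∀ v, B u v + B v u = 0} = p ^ r) :
    ∃ X Y : ℤ, (p : ℤ) * X ^ 2 + Y ^ 2 = 4 * (p : ℤ) ^ (m + r - 1) ∧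
      2 * (#{x | B x x = 0} : ℤ) = 2 * p ^ (m - 1) - (p - 1) * X ∧ (p = 3 → Even X) := by
  obtain ⟨m, rfl⟩ : ∃ m', m = m' + 1 := ⟨m - 1, by omega⟩
  have hp := Fact.out (p := p.Prime)
  have hp3 : 3 ≤ p := by have := hp.two_le; omega
  have hchar : ringChar (ZMod p) ≠ 2 := by rwa [ZMod.ringChar_zmod_n]
  have h2 : (2 : ZMod p) ≠ 0 := Ring.two_ne_zero hchar
  set N : ZMod p → ℤ := fun t => #{x | B x x = t} with hN
  have hscale : ∀ c t : ZMod p, c ≠ 0 → N (c ^ 2 * t) = N t := by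
    intro c t hc
    simp only [hN]
    norm_cast
    refine (Finset.card_bij (fun x _ => c • x) ?_ ?_ ?_).symm
    · intro x hx
      simp only [mem_filter, mem_univ, true_and] at hx ⊢
      simp [hx, sq, mul_assoc]
    · intro x _ y _ h
      exact (smul_right_injective V hc) h
    · intro y hy
      simp only [mem_filter, mem_univ, true_and] at hy ⊢
      refine ⟨c⁻¹ • y, ?_, by simp [smul_smul, hc]⟩
      simp [hy]; field_simp
  obtain ⟨l, hl⟩ := quadraticChar_exists_neg_one' hchar
  have hl0 : (l : ZMod p) ≠ 0 := l.ne_zero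
  set S := N 1 + N l with hS
  set Y := N 1 - N l with hY
  have hval : ∀ t : ZMod p, t ≠ 0 → 2 * N t = S + quadraticChar (ZMod p) t * Y := by
    intro t ht
    rcases quadraticChar_dichotomy ht with h | h
    · obtain ⟨c, hc⟩ := (quadraticChar_one_iff_isSquare ht).mp h
      have hc0 : c ≠ 0 := by rintro rfl; simp at hc; exact ht hc
      have := hscale c 1 hc0
      rw [mul_one, sq, ← hc] at this
      rw [h, this, hS, hY]; ring
    · have h1 : quadraticChar (ZMod p) (t * l) = 1 := by rw [map_mul, h, hl]; rfl
      obtain ⟨c, hc⟩ := (quadraticChar_one_iff_isSquare (mul_ne_zero ht hl0)).mp h1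
      have hc0 : c ≠ 0 := by rintro rfl; simp [ht] at hc
      have := hscale (c / l) l (div_ne_zero hc0 hl0)
      rw [show (c / (l : ZMod p)) ^ 2 * l = t by
        field_simp; rw [sq, ← hc, mul_comm]] at this
      rw [h, this, hS, hY]; ring
  have hchi : ∑ t ∈ univ.erase (0 : ZMod p), quadraticChar (ZMod p) t = 0 := by
    rw [← quadraticChar_sum_zero hchar, ← Finset.add_sum_erase univ _ (mem_univ 0)]
    simp
  have hcard : (#(univ.erase (0 : ZMod p)) : ℤ) = p - 1 := by
    rw [card_erase_of_mem (mem_univ _), card_univ, ZMod.card, Nat.cast_sub hp.one_le]; simp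
  have hsum1 : ∑ t, N t = p ^ (m + 1) := by
    simp only [hN]
    rw [← Nat.cast_sum, ← Finset.card_eq_sum_card_fiberwise (fun _ _ => mem_coe.2 (mem_univ _)), card_univ, hV]
    push_cast; rfl
  have e1 : 2 * N 0 + (p - 1) * S = 2 * p ^ (m + 1) := by
    rw [← hsum1, ← Finset.add_sum_erase univ N (mem_univ 0), mul_add (2 : ℤ), Finset.mul_sum,
      Finset.sum_congr rfl fun t ht => hval t (ne_of_mem_erase ht), Finset.sum_add_distrib,
      ← Finset.sum_mul, hchi, sum_const, nsmul_eq_mul, hcard]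
    ring
  have hsum2 : ∑ t, N t ^ 2 = #{z : V × V | B z.1 z.1 = B z.2 z.2} := by
    rw [Finset.card_eq_sum_card_fiberwise (f := fun z : V × V => B z.1 z.1) (t := univ)
      (fun _ _ => mem_coe.2 (mem_univ _)), Nat.cast_sum]
    refine Finset.sum_congr rfl fun t _ => ?_
    simp only [hN, sq]
    norm_cast
    rw [← Finset.card_product]
    congr 1
    ext ⟨x, y⟩
    simp only [mem_product, mem_filter, mem_univ, true_and]
    constructor
    · rintro ⟨h, h'⟩; exact ⟨h.trans h'.symm, h⟩
    · rintro ⟨h, h'⟩; exact ⟨h', h ▸ h'⟩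
  -- Substituting (v+u, v-u) turns a difference of two values of the form into twice the polar form.
  have hpolar : #{z : V × V | B z.1 z.1 = B z.2 z.2} =
      #{z : V × V | B z.1 z.2 + B z.2 z.1 = 0} := by
    refine (Finset.card_bij (fun z _ => (z.2 + z.1, z.2 - z.1)) ?_ ?_ ?_).symm
    · rintro ⟨u, v⟩ h
      simp only [mem_filter, mem_univ, true_and, map_add, map_sub, LinearMap.add_apply,
        LinearMap.sub_apply] at h ⊢
      linear_combination 2 * h
    · rintro ⟨u, v⟩ _ ⟨u', v'⟩ _ h
      simp only [Prod.mk.injEq] at h ⊢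
      have hu : (2 : ZMod p) • u = (2 : ZMod p) • u' := by
        have := congrArg₂ (· - ·) h.1 h.2
        rw [two_smul, two_smul]
        convert this using 1 <;> abel
      have hu' := smul_right_injective V h2 hu
      refine ⟨hu', ?_⟩
      have := h.1
      rw [hu'] at this
      exact add_right_cancel this
    · rintro ⟨x, y⟩ h
      have hxy : ∀ a b : V, (2⁻¹ : ZMod p) • (a + b) + (2⁻¹ : ZMod p) • (a - b) = a := by
        intro a b
        rw [← smul_add, add_add_sub_cancel, ← two_smul (ZMod p) a, smul_smul, inv_mul_cancel₀ h2, one_smul]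
      have hxy' : ∀ a b : V, (2⁻¹ : ZMod p) • (a + b) - (2⁻¹ : ZMod p) • (a - b) = b := by
        intro a b
        rw [← smul_sub, add_sub_sub_cancel, ← two_smul (ZMod p) b, smul_smul, inv_mul_cancel₀ h2, one_smul]
      refine ⟨((2⁻¹ : ZMod p) • (x - y), (2⁻¹ : ZMod p) • (x + y)), ?_, ?_⟩
      · simp only [mem_filter, mem_univ, true_and, map_add, map_sub, LinearMap.add_apply,
          LinearMap.sub_apply, map_smul, LinearMap.smul_apply, smul_eq_mul] at h ⊢
        linear_combination (2 * 2⁻¹ * 2⁻¹) * h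
      · simp only [hxy, hxy']
  -- The fibre over u is all of V when u lies in the radical and a hyperplane otherwise.
  have hcount : (p : ℤ) * #{z : V × V | B z.1 z.2 + B z.2 z.1 = 0} =
      p ^ r * p ^ (m + 1) * p + (p ^ (m + 1) - p ^ r) * p ^ (m + 1) := by
    rw [Finset.card_eq_sum_card_fiberwise (f := fun z : V × V => z.1) (t := univ)
      (fun _ _ => mem_coe.2 (mem_univ _)), Nat.cast_sum, Finset.mul_sum]
    have hfib : ∀ u : V, #{z ∈ ({z : V × V | B z.1 z.2 + B z.2 z.1 = 0} : Finset (V × V)) | z.1 = u} =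
        #{v | (B u + B.flip u) v = 0} := by
      intro u
      refine (Finset.card_bij (fun v _ => (u, v)) ?_ ?_ ?_).symm
      · intro v hv; simp only [mem_filter, mem_univ, true_and] at hv ⊢; simpa using hv
      · intro v _ v' _ h; simpa using h
      · rintro ⟨u', v⟩ h
        simp only [mem_filter, mem_univ, true_and] at h
        obtain ⟨h, rfl⟩ := h
        exact ⟨v, by simp only [mem_filter, mem_univ, true_and]; simpa using h, rfl⟩
    have hterm : ∀ u : V, (p : ℤ) * (#{z ∈ ({z : V × V | B z.1 z.2 + B z.2 z.1 = 0} : Finset (V × V)) | z.1 = u} : ℤ) =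
        p ^ (m + 1) + if ∀ v, B u v + B v u = 0 then (p - 1 : ℤ) * p ^ (m + 1) else 0 := by
      intro u
      rw [hfib]
      split_ifs with h
      · rw [Finset.filter_true_of_mem (by simpa using h), card_univ, hV]
        push_cast; ring
      · rw [add_zero]
        have := card_filter_functional_eq_zero (B u + B.flip u)
          (fun h0 => h fun v => by simpa using LinearMap.congr_fun h0 v)
        rw [hV] at this
        exact_mod_cast this
    rw [Finset.sum_congr rfl fun u _ => hterm u, Finset.sum_add_distrib, ← Finset.sum_filter,
      sum_const, sum_const, hR, card_univ, hV]
    simp only [nsmul_eq_mul]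
    push_cast
    ring
  have e2 : 4 * N 0 ^ 2 + (p - 1) * (S ^ 2 + Y ^ 2) = 4 * ∑ t, N t ^ 2 := by
    rw [← Finset.add_sum_erase univ _ (mem_univ 0), mul_add (4 : ℤ), Finset.mul_sum]
    have : ∀ t ∈ univ.erase (0 : ZMod p), 4 * N t ^ 2 =
        (S ^ 2 + Y ^ 2) + quadraticChar (ZMod p) t * (2 * S * Y) := by
      intro t ht
      have ht0 := ne_of_mem_erase ht
      have hq := quadraticChar_sq_one ht0
      have := hval t ht0
      linear_combination (2 * N t + S + quadraticChar (ZMod p) t * Y) * this + Y ^ 2 * hq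
    rw [Finset.sum_congr rfl this, Finset.sum_add_distrib, ← Finset.sum_mul, hchi, sum_const,
      nsmul_eq_mul, hcard]
    ring
  rw [hsum2, hpolar] at e2
  have hN0 : (#{x | B x x = 0} : ℤ) = N 0 := rfl
  have hp0 : (p : ℤ) ≠ 0 := by exact_mod_cast hp.ne_zero
  have hp1 : (p - 1 : ℤ) ≠ 0 := by
    have : (3 : ℤ) ≤ p := by exact_mod_cast hp3
    omega
  -- After the shift of m the space has p^(m+1) elements, so X measures the deviation of S from its
  -- equidistributed value 2p^m.
  refine ⟨S - 2 * p ^ m, Y, ?_, ?_, ?_⟩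
  · rw [show m + 1 + r - 1 = m + r by omega]
    apply mul_left_cancel₀ (mul_ne_zero hp0 hp1)
    have e1' : 2 * N 0 = 2 * p ^ (m + 1) - (p - 1) * S := by linear_combination e1
    have e3 : (2 * N 0) ^ 2 + (p - 1) * (S ^ 2 + Y ^ 2) = 4 * #{z : V × V | B z.1 z.2 + B z.2 z.1 = 0} := by
      linear_combination e2
    rw [e1'] at e3
    rw [pow_add]
    rw [pow_succ] at *
    linear_combination p * e3 + 4 * hcount
  · rw [hN0, Nat.add_sub_cancel]
    rw [pow_succ] at e1
    linear_combination e1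
  · intro h3
    -- The zeros are paired by x ↦ -x, and only 0 is its own partner.
    have hodd : Odd #{x | B x x = 0} := by
      have h0 : (0 : V) ∈ ({x | B x x = 0} : Finset V) := by simp
      rw [← Finset.card_erase_add_one h0]
      apply Even.add_one
      rw [← ZMod.natCast_eq_zero_iff_even, Finset.card_eq_sum_ones, Nat.cast_sum]
      refine Finset.sum_involution (fun x _ => -x) ?_ ?_ ?_ ?_
      · intro _ _; decide
      · intro x hx _ hxx
        refine ne_of_mem_erase hx ?_
        have : (2 : ZMod p) • x = 0 := by
          rw [two_smul]; nth_rewrite 1 [← hxx]; exact neg_add_cancel x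
        exact (smul_eq_zero.mp this).resolve_left h2
      · intro x hx; simpa using hx
      · intro x _; exact neg_neg x
    have hX : (#{x | B x x = 0} : ℤ) = 3 ^ m - (S - 2 * p ^ m) := by
      rw [hN0]
      rw [pow_succ] at e1
      subst h3
      push_cast at e1 ⊢
      linarith
    have hodd' : Odd (#{x | B x x = 0} : ℤ) := by exact_mod_cast hodd
    rw [hX] at hodd'
    have h3m : Odd ((3 : ℤ) ^ m) := Odd.pow (by decide)
    by_contra hX
    rw [Int.not_even_iff_odd] at hX
    exact (Int.not_odd_iff_even.mpr (h3m.sub_odd hX)) hodd'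

/-- If the rank of a quadratic form is odd, its zeros are equidistributed. -/
theorem card_zeros_of_rank_odd (hp2 : p ≠ 2) (B : V →ₗ[ZMod p] V →ₗ[ZMod p] ZMod p) {m r : ℕ}
    (hm : 0 < m) (hV : Fintype.card V = p ^ m) (hmr : Odd (m + r))
    (hR : #{u : V | ∀ v, B u v + B v u = 0} = p ^ r) :
    #{x | B x x = 0} = p ^ (m - 1) := by
  obtain ⟨X, Y, h1, h2, h3⟩ := exists_sq_add_sq_of_bilin hp2 B hm hV hR
  obtain ⟨j, hj⟩ := hmr
  rw [show m + r - 1 = 2 * j by omega] at h1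
  rw [eq_zero_of_mul_sq_add_sq_eq Fact.out hp2 j X Y h1 h3] at h2
  have : (#{x | B x x = 0} : ℤ) = p ^ (m - 1) := by linarith
  exact_mod_cast this

theorem card_zeros_of_rank_even (hp2 : p ≠ 2) (B : V →ₗ[ZMod p] V →ₗ[ZMod p] ZMod p) {m r j : ℕ}
    (hm : 0 < m) (hV : Fintype.card V = p ^ m) (hmr : m + r = 2 * j + 2)
    (hR : #{u : V | ∀ v, B u v + B v u = 0} = p ^ r) :
    (#{x | B x x = 0} : ℤ) = p ^ (m - 1) + (p - 1) * p ^ j ∨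
      (#{x | B x x = 0} : ℤ) = p ^ (m - 1) - (p - 1) * p ^ j := by
  obtain ⟨X, Y, h1, h2, h3⟩ := exists_sq_add_sq_of_bilin hp2 B hm hV hR
  rw [show m + r - 1 = 2 * j + 1 by omega] at h1
  rcases sq_eq_of_mul_sq_add_sq_eq Fact.out hp2 j X Y h1 h3 with h | h
  · right; rw [h] at h2; linarith
  · left; rw [h] at h2; linarith

end ZeroCount

/-! ### Radicals of the forms Tr(ay² + byσ(y)) -/

section Radical

variable {F E : Type*} [Field F] [Field E] [Algebra F E]

/-- The norm is σ-invariant, while in odd degree it changes sign with its argument. -/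
theorem eq_zero_of_algEquiv_eq_neg [FiniteDimensional F E] (h2 : (2 : F) ≠ 0) (hodd : Odd (Module.finrank F E))
    (σ : E ≃ₐ[F] E) {w : E} (hw : σ w = -w) : w = 0 := by
  have h := Algebra.norm_eq_of_algEquiv σ w
  rw [hw, show -w = algebraMap F E (-1) * w by simp, map_mul, Algebra.norm_algebraMap,
    hodd.neg_one_pow] at h
  have h0 : 2 * Algebra.norm F w = 0 := by linear_combination -h
  exact Algebra.norm_eq_zero_iff.mp ((mul_eq_zero.mp h0).resolve_left h2)

theorem eq_zero_of_trace_mul_eq_zero [FiniteDimensional F E] [Algebra.IsSeparable F E] {z : E}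
    (h : ∀ x, Algebra.trace F E (x * z) = 0) : z = 0 := by
  refine (traceForm_nondegenerate F E).2 z fun x => ?_
  rw [Algebra.traceForm_apply, h]

/-- The bilinear form `(x, y) ↦ Tr (a x y + b x σ(y))`. -/
noncomputable def traceBilin (σ : E ≃ₐ[F] E) (a b : E) : E →ₗ[F] E →ₗ[F] F :=
  LinearMap.mk₂ F (fun x y => Algebra.trace F E (a * x * y + b * x * σ y))
    (fun x x' y => by rw [← map_add]; congr 1; ring)
    (fun c x y => by
      rw [← map_smul]; congr 1; simp only [Algebra.smul_def]; ring)
    (fun x y y' => by rw [← map_add]; congr 1; rw [map_add]; ring)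
    (fun c x y => by
      rw [← map_smul, map_smul σ]; congr 1; simp only [Algebra.smul_def]; ring)

theorem traceBilin_apply (σ : E ≃ₐ[F] E) (a b x y : E) :
    traceBilin σ a b x y = Algebra.trace F E (a * x * y + b * x * σ y) := rfl

/-- Invariance of the trace under σ rewrites every term as a pairing with σ(x), and the trace form
is nondegenerate. -/
theorem traceBilin_polar_eq_zero_iff [FiniteDimensional F E] [Algebra.IsSeparable F E] (σ : E ≃ₐ[F] E) (a b y : E) :
    (∀ x, traceBilin σ a b y x + traceBilin σ a b x y = 0) ↔
      b * y + 2 * σ a * σ y + σ b * σ (σ y) = 0 := by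
  have h : ∀ x, traceBilin σ a b y x + traceBilin σ a b x y =
      Algebra.trace F E (σ x * (b * y + 2 * σ a * σ y + σ b * σ (σ y))) := by
    intro x
    have h1 : Algebra.trace F E (σ x * (2 * σ a * σ y + σ b * σ (σ y))) =
        Algebra.trace F E (x * (2 * a * y + b * σ y)) := by
      rw [← Algebra.trace_eq_of_algEquiv σ (x * (2 * a * y + b * σ y))]
      simp [map_ofNat]
    rw [add_assoc, mul_add (σ x), map_add, h1, traceBilin_apply, traceBilin_apply, ← map_add,
      ← map_add]
    congr 1
    ring
  simp only [h]
  constructor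
  · intro h0
    refine eq_zero_of_trace_mul_eq_zero (F := F) fun x => ?_
    rw [← h0 (σ.symm x), AlgEquiv.apply_symm_apply]
  · intro h0 x
    rw [h0, mul_zero, map_zero]

theorem polar_radical_eq_zero_or [FiniteDimensional F E] (h2 : (2 : F) ≠ 0) (hodd : Odd (Module.finrank F E))
    (σ : E ≃ₐ[F] E) {a b y z : E} (hab : a ≠ 0 ∨ b ≠ 0)
    (hy : b * y + 2 * σ a * σ y + σ b * σ (σ y) = 0)
    (hz : b * z + 2 * σ (-a) * σ z + σ b * σ (σ z) = 0) : y = 0 ∨ z = 0 := by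
  have h2E : (2 : E) ≠ 0 := by
    rw [← map_ofNat (algebraMap F E) 2]
    exact (map_ne_zero (algebraMap F E)).mpr h2
  by_cases hb : b = 0
  · subst hb
    simp_all
  by_contra! hyz
  -- Combining the equations of y and z cancels the terms in a and shows that σ negates this
  -- element; the next use of the same principle has σ negating z/y.
  have hw : b * (y * σ z + z * σ y) = 0 := by
    apply eq_zero_of_algEquiv_eq_neg h2 hodd σ
    simp only [map_mul, map_add, map_neg] at hz ⊢
    linear_combination σ z * hy + σ y * hz
  have hw' := (mul_eq_zero.mp hw).resolve_left hb
  have := eq_zero_of_algEquiv_eq_neg h2 hodd σ (w := z / y) (by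
    rw [map_div₀]
    have : σ y ≠ 0 := by simpa using hyz.1
    have := hyz.1
    field_simp
    linear_combination hw')
  simp_all

/-- A second-order σ-linear equation: the Wronskian b(y₀σ(y) - yσ(y₀)) of two solutions is fixed by
σ, so the solutions form a space of dimension at most two over the fixed field of σ. -/
theorem card_polar_radical (h2 : (2 : F) ≠ 0) (σ : E ≃ₐ[F] E) {a b : E}
    (hab : a ≠ 0 ∨ b ≠ 0) :
    Nat.card {y : E // b * y + 2 * σ a * σ y + σ b * σ (σ y) = 0} = 1 ∨
    Nat.card {y : E // b * y + 2 * σ a * σ y + σ b * σ (σ y) = 0} = Nat.card {x : E // σ x = x} ∨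
    Nat.card {y : E // b * y + 2 * σ a * σ y + σ b * σ (σ y) = 0} =
      Nat.card {x : E // σ x = x} ^ 2 := by
  have h2E : (2 : E) ≠ 0 := by
    rw [← map_ofNat (algebraMap F E) 2]
    exact (map_ne_zero (algebraMap F E)).mpr h2
  by_cases htriv : ∀ y, b * y + 2 * σ a * σ y + σ b * σ (σ y) = 0 → y = 0
  · left
    rw [Nat.card_eq_one_iff_unique]
    exact ⟨⟨fun x y => Subtype.ext ((htriv _ x.2).trans (htriv _ y.2).symm)⟩, ⟨⟨0, by simp⟩⟩⟩
  right
  push Not at htriv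
  obtain ⟨y₀, hy₀, hne⟩ := htriv
  have hσ0 : σ y₀ ≠ 0 := by simpa using hne
  have hb : b ≠ 0 := by
    rintro rfl
    simp_all
  have hfix : ∀ y, b * y + 2 * σ a * σ y + σ b * σ (σ y) = 0 →
      σ (b * (y₀ * σ y - y * σ y₀)) = b * (y₀ * σ y - y * σ y₀) := by
    intro y hy
    simp only [map_mul, map_sub]
    linear_combination σ y₀ * hy - σ y * hy₀
  have hmul : ∀ y, y₀ * σ y - y * σ y₀ = 0 → σ (y / y₀) = y / y₀ := by
    intro y hy
    rw [map_div₀]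
    field_simp
    linear_combination hy
  have hcomb : ∀ s y, σ s = s → b * y + 2 * σ a * σ y + σ b * σ (σ y) = 0 →
      b * (s * y) + 2 * σ a * σ (s * y) + σ b * σ (σ (s * y)) = 0 := by
    intro s y hs hy
    simp only [map_mul, hs]
    linear_combination s * hy
  by_cases hall : ∀ y, b * y + 2 * σ a * σ y + σ b * σ (σ y) = 0 → y₀ * σ y - y * σ y₀ = 0
  · left
    exact Nat.card_congr
      { toFun := fun y => ⟨y / y₀, hmul _ (hall _ y.2)⟩
        invFun := fun s => ⟨s * y₀, hcomb s y₀ s.2 hy₀⟩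
        left_inv := fun y => Subtype.ext (by simp [hne])
        right_inv := fun s => Subtype.ext (by simp [hne]) }
  · right
    push Not at hall
    obtain ⟨y₁, hy₁, hne₁⟩ := hall
    set c := y₀ * σ y₁ - y₁ * σ y₀ with hc
    have hquot : ∀ y, b * y + 2 * σ a * σ y + σ b * σ (σ y) = 0 →
        σ ((y₀ * σ y - y * σ y₀) / c) = (y₀ * σ y - y * σ y₀) / c := by
      intro y hy
      rw [← mul_div_mul_left _ _ hb, map_div₀, hfix y hy, hfix y₁ hy₁]
    rw [sq, ← Nat.card_prod]
    -- The ratio of Wronskians is the y₁-coordinate; removing that component leaves a fixed multiple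
    -- of y₀.
    have hres : ∀ y, b * y + 2 * σ a * σ y + σ b * σ (σ y) = 0 →
        y₀ * σ (y - (y₀ * σ y - y * σ y₀) / c * y₁) -
          (y - (y₀ * σ y - y * σ y₀) / c * y₁) * σ y₀ = 0 := by
      intro y hy
      rw [map_sub, map_mul, hquot y hy]
      field_simp
      rw [hc]
      ring
    exact Nat.card_congr
      { toFun := fun y => (⟨(y - (y₀ * σ y - y * σ y₀) / c * y₁) / y₀, hmul _ (hres _ y.2)⟩,
          ⟨(y₀ * σ y - y * σ y₀) / c, hquot _ y.2⟩)
        invFun := fun s => ⟨s.1 * y₀ + s.2 * y₁, by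
          have h1 := hcomb s.1 y₀ s.1.2 hy₀
          have h2 := hcomb s.2 y₁ s.2.2 hy₁
          simp only [map_add] at h1 h2 ⊢
          linear_combination h1 + h2⟩
        left_inv := fun y => Subtype.ext (by simp [hne])
        right_inv := fun s => by
          have hs1 := s.1.2
          have hs2 := s.2.2
          have key : (y₀ * σ (s.1 * y₀ + s.2 * y₁) - (s.1 * y₀ + s.2 * y₁) * σ y₀) / c = s.2 := by
            rw [map_add, map_mul, map_mul, hs1, hs2, div_eq_iff hne₁, hc]
            ring
          refine Prod.ext (Subtype.ext ?_) (Subtype.ext key)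
          simp only [key]
          field_simp
          ring }

end Radical

/-! ### Zero counts for a and -a together -/

section FiniteField

variable {p : ℕ} [Fact p.Prime] {E : Type*} [Field E] [Fintype E]

/-- The nonzero fixed points are the kernel of the (p^k-1)-th power map on a cyclic group of order
p^m-1; `Option` adjoins 0. -/
theorem card_fixed_pow {m k : ℕ} (hE : Fintype.card E = p ^ m) :
    Nat.card {x : E // x ^ p ^ k = x} = p ^ Nat.gcd m k := by
  classical
  have hp := Fact.out (p := p.Prime)
  have hk0 : p ^ k ≠ 0 := pow_ne_zero _ hp.ne_zero
  have hcard := IsCyclic.card_powMonoidHom_ker (G := Eˣ) (p ^ k - 1)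
  rw [Nat.card_eq_fintype_card (α := Eˣ), Fintype.card_units, hE,
    Nat.pow_sub_one_gcd_pow_sub_one] at hcard
  have hequiv : {x : E // x ^ p ^ k = x} ≃ Option (powMonoidHom (p ^ k - 1) : Eˣ →* Eˣ).ker :=
    { toFun := fun x => if h : (x : E) = 0 then none else some ⟨Units.mk0 x h, by
        rw [MonoidHom.mem_ker, powMonoidHom_apply]
        ext
        push_cast
        apply mul_right_cancel₀ h
        rw [Units.val_mk0, ← pow_succ, Nat.sub_add_cancel (Nat.pos_of_ne_zero hk0), x.2, one_mul]⟩
      invFun := fun o => o.elim ⟨0, zero_pow hk0⟩ fun u => ⟨(u : Eˣ), by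
        have := u.2
        rw [MonoidHom.mem_ker, powMonoidHom_apply] at this
        have h := congrArg (Units.val) this
        push_cast at h
        calc ((u : Eˣ) : E) ^ p ^ k = ((u : Eˣ) : E) ^ (p ^ k - 1) * ((u : Eˣ) : E) := by
              rw [← pow_succ, Nat.sub_add_cancel (Nat.pos_of_ne_zero hk0)]
          _ = _ := by rw [h, one_mul]⟩
      left_inv := fun x => by
        by_cases h : (x : E) = 0
        · simp [h, ← Subtype.coe_inj]
        · simp [h]
      right_inv := fun o => by
        cases o with
        | none => simp
        | some u => simp }
  rw [Nat.card_congr hequiv, Finite.card_option, hcard,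
    Nat.sub_add_cancel (Nat.one_le_pow _ _ hp.pos)]

open Classical in
theorem card_zeros_traceBilin_add [Algebra (ZMod p) E] (hp2 : p ≠ 2) {m k e : ℕ} (hE : Fintype.card E = p ^ m)
    (hm : Odd m) (he : Odd e) (hgcd : e = Nat.gcd m k) (σ : E ≃ₐ[ZMod p] E)
    (hσ : ∀ x, σ x = x ^ p ^ k) {a b : E} (hab : a ≠ 0 ∨ b ≠ 0) :
    ∃ ε : ℤ, (ε = 0 ∨ ε = 1 ∨ ε = -1) ∧
      (#{y | traceBilin σ a b y y = 0} : ℤ) + #{y | traceBilin σ (-a) b y y = 0} =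
        2 * p ^ (m - 1) + ε * ((p - 1) * p ^ ((m + e - 2) / 2)) := by
  have hp := Fact.out (p := p.Prime)
  have h2 : (2 : ZMod p) ≠ 0 := Ring.two_ne_zero (by rwa [ZMod.ringChar_zmod_n])
  have hfin : Module.finrank (ZMod p) E = m := by
    have := FiniteField.pow_finrank_eq_card p E
    rw [hE] at this
    exact Nat.pow_right_injective hp.two_le this
  have hrad : ∀ a b : E, #{u | ∀ v, traceBilin σ a b u v + traceBilin σ a b v u = 0} =
      Nat.card {y : E // b * y + 2 * σ a * σ y + σ b * σ (σ y) = 0} := by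
    intro a b
    rw [Nat.card_eq_fintype_card, Fintype.card_subtype]
    simp only [traceBilin_polar_eq_zero_iff]
  have hfix : Nat.card {x : E // σ x = x} = p ^ e := by
    simp only [hσ]
    rw [card_fixed_pow hE, hgcd]
  have hone : ∀ a b : E, (∀ y, b * y + 2 * σ a * σ y + σ b * σ (σ y) = 0 → y = 0) →
      (#{y | traceBilin σ a b y y = 0} : ℤ) = p ^ (m - 1) := by
    intro a b h
    exact_mod_cast card_zeros_of_rank_odd hp2 (traceBilin σ a b) (r := 0) hm.pos hE (by simpa using hm) (by
      rw [hrad, pow_zero, Nat.card_eq_one_iff_unique]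
      exact ⟨⟨fun x y => Subtype.ext ((h _ x.2).trans (h _ y.2).symm)⟩, ⟨⟨0, by simp⟩⟩⟩)
  have hgen : ∀ a b : E, (a ≠ 0 ∨ b ≠ 0) → ∃ ε : ℤ, (ε = 0 ∨ ε = 1 ∨ ε = -1) ∧
      (#{y | traceBilin σ a b y y = 0} : ℤ) =
        p ^ (m - 1) + ε * ((p - 1) * p ^ ((m + e - 2) / 2)) := by
    intro a b hab
    rcases card_polar_radical h2 σ hab with h | h | h
    · refine ⟨0, Or.inl rfl, ?_⟩
      rw [← hrad, ← pow_zero p] at h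
      rw [card_zeros_of_rank_odd hp2 _ hm.pos hE (by simpa using hm) h]
      simp
    · rw [← hrad, hfix] at h
      have := hm.pos
      have := he.pos
      obtain ⟨c, hc⟩ := hm.add_odd he
      rcases card_zeros_of_rank_even hp2 _ hm.pos hE (j := (m + e - 2) / 2) (by omega) h with h | h
      · exact ⟨1, by simp, by rw [h]; ring⟩
      · exact ⟨-1, by simp, by rw [h]; ring⟩
    · refine ⟨0, Or.inl rfl, ?_⟩
      rw [← hrad, hfix, ← pow_mul] at h
      rw [card_zeros_of_rank_odd hp2 _ hm.pos hE (hm.add_even (by simp)) h]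
      simp
  -- One of the two radicals is trivial; that form has rank m, which is odd, and contributes exactly
  -- p^(m-1).
  by_cases htriv : ∀ y, b * y + 2 * σ a * σ y + σ b * σ (σ y) = 0 → y = 0
  · obtain ⟨ε, hε, h⟩ := hgen (-a) b (by simpa using hab)
    exact ⟨ε, hε, by rw [hone a b htriv, h]; ring⟩
  · push Not at htriv
    obtain ⟨y, hy, hy0⟩ := htriv
    obtain ⟨ε, hε, h⟩ := hgen a b hab
    refine ⟨ε, hε, ?_⟩
    rw [h, hone (-a) b]
    · ring
    · intro z hz
      exact (polar_radical_eq_zero_or h2 (hfin ▸ hm) σ hab hy hz).resolve_left hy0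

end FiniteField

/-! ### Trace functionals and their moments -/

section Counting

variable {p : ℕ} [Fact p.Prime] {E : Type*} [Field E] [Fintype E] [Algebra (ZMod p) E]

-- An element x has 1 + χ(x) square roots; substituting lx reverses the sign of χ, so the character
-- terms cancel.
open Classical in
theorem two_mul_sum_eq_sum_sq_add_sum_nonsquare (h2 : ringChar E ≠ 2) {l : E}
    (hl : quadraticChar E l = -1) (f : E → ℤ) :
    2 * ∑ x, f x = ∑ y, f (y ^ 2) + ∑ y, f (l * y ^ 2) := by
  have hl0 : l ≠ 0 := by rintro rfl; simp at hl
  have hsq : ∀ g : E → ℤ, ∑ y, g (y ^ 2) = ∑ x, g x * (1 + quadraticChar E x) := by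
    intro g
    rw [← Finset.sum_fiberwise univ (fun y : E => y ^ 2) fun y => g (y ^ 2)]
    refine Finset.sum_congr rfl fun x _ => ?_
    rw [Finset.sum_congr rfl (g := fun _ => g x) (by simp +contextual), sum_const, nsmul_eq_mul,
      mul_comm, add_comm (1 : ℤ), ← quadraticChar_card_sqrts h2 x]
    congr 3
    ext y
    simp
  rw [hsq f, hsq fun x => f (l * x),
    ← Equiv.sum_comp (Equiv.mulLeft₀ l hl0) fun x => f x * (1 + quadraticChar E x),
    ← Equiv.sum_comp (Equiv.mulLeft₀ l hl0) f, ← Finset.sum_add_distrib, Finset.mul_sum]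
  refine Finset.sum_congr rfl fun x _ => ?_
  simp only [Equiv.mulLeft₀_apply, map_mul, hl]
  ring

open Classical in
/-- The functional `(a, b) ↦ Tr (a χ(x) x + b x ^ d)`, with `χ` the quadratic character. -/
noncomputable def traceFunctional (p : ℕ) [Fact p.Prime] [Algebra (ZMod p) E] (d : ℕ) (x : E) :
    (E × E) →ₗ[ZMod p] ZMod p where
  toFun ab := Algebra.trace (ZMod p) E (ab.1 * ((quadraticChar E x : ℤ) * x) + ab.2 * x ^ d)
  map_add' u v := by rw [← map_add, Prod.fst_add, Prod.snd_add]; congr 1; ring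
  map_smul' c u := by
    rw [RingHom.id_apply, ← map_smul, Prod.smul_fst, Prod.smul_snd]
    congr 1
    simp only [Algebra.smul_def]; ring

open Classical in
theorem traceFunctional_apply (d : ℕ) (x : E) (ab : E × E) :
    traceFunctional p d x ab =
      Algebra.trace (ZMod p) E (ab.1 * ((quadraticChar E x : ℤ) * x) + ab.2 * x ^ d) := rfl

theorem traceFunctional_ne_zero (d : ℕ) {x : E} (hx : x ≠ 0) : traceFunctional p d x ≠ 0 := by
  intro h
  refine pow_ne_zero d hx (eq_zero_of_trace_mul_eq_zero (F := ZMod p) fun a => ?_)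
  have := LinearMap.congr_fun h (0, a)
  simpa [traceFunctional_apply] using this

/-- Taking norms makes an odd power of l a square. -/
theorem isSquare_of_isSquare_algebraMap (hodd : Odd (Module.finrank (ZMod p) E)) {l : ZMod p}
    (h : IsSquare (algebraMap (ZMod p) E l)) : IsSquare l := by
  obtain ⟨y, hy⟩ := h
  have h := congrArg (Algebra.norm (ZMod p)) hy
  rw [Algebra.norm_algebraMap, map_mul] at h
  obtain ⟨j, hj⟩ := hodd
  by_cases hl : l = 0
  · exact ⟨0, by simp [hl]⟩
  refine ⟨Algebra.norm (ZMod p) y / l ^ j, ?_⟩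
  rw [hj, pow_succ] at h
  field_simp
  linear_combination h

open Classical in
theorem quadraticChar_algebraMap (hodd : Odd (Module.finrank (ZMod p) E)) (l : ZMod p) :
    quadraticChar E (algebraMap (ZMod p) E l) = quadraticChar (ZMod p) l := by
  by_cases hl : l = 0
  · simp [hl]
  have hl' : algebraMap (ZMod p) E l ≠ 0 := by simpa using hl
  rcases quadraticChar_dichotomy hl with h | h
  · rw [h, quadraticChar_one_iff_isSquare hl']
    exact ((quadraticChar_one_iff_isSquare hl).mp h).map _
  · rw [h, quadraticChar_neg_one_iff_not_isSquare]
    rw [quadraticChar_neg_one_iff_not_isSquare] at h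
    exact fun h' => h (isSquare_of_isSquare_algebraMap hodd h')

theorem ringChar_ne_two_of_algebra (E : Type*) [Field E] [Algebra (ZMod p) E] (hp2 : p ≠ 2) :
    ringChar E ≠ 2 := by
  have := charP_of_injective_algebraMap (algebraMap (ZMod p) E).injective p
  rwa [ringChar.eq E p]

open Classical in
theorem two_mul_card_traceFunctional_zeros (hp2 : p ≠ 2) (hodd : Odd (Module.finrank (ZMod p) E))
    (σ : E ≃ₐ[ZMod p] E) {d : ℕ} (hd : ∀ y : E, (y ^ 2) ^ d = y * σ y)
    (hdF : ∀ c : ZMod p, c ^ d = c) (a b : E) :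
    2 * (#{x : E | traceFunctional p d x (a, b) = 0} : ℤ) =
      #{y | traceBilin σ a b y y = 0} + #{y | traceBilin σ (-a) b y y = 0} := by
  have h2 := ringChar_ne_two_of_algebra E hp2
  obtain ⟨l, hl⟩ := quadraticChar_exists_neg_one' (F := ZMod p) (by rwa [ZMod.ringChar_zmod_n])
  have hl0 : (l : ZMod p) ≠ 0 := l.ne_zero
  have hlE : quadraticChar E (algebraMap (ZMod p) E l) = -1 := by
    rw [quadraticChar_algebraMap hodd, hl]
  have key := two_mul_sum_eq_sum_sq_add_sum_nonsquare h2 hlE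
    fun x => if traceFunctional p d x (a, b) = 0 then 1 else 0
  simp only [← Finset.natCast_card_filter] at key
  rw [key]
  have h1 : ∀ y : E, traceFunctional p d (y ^ 2) (a, b) = traceBilin σ a b y y := by
    intro y
    by_cases hy : y = 0
    · subst hy
      have : d ≠ 0 := by
        rintro rfl
        simpa using hdF 0
      simp [traceFunctional_apply, this]
    · rw [traceFunctional_apply, traceBilin_apply, hd, quadraticChar_sq_one' hy]
      congr 1
      dsimp only
      push_cast
      ring
  have h3 : ∀ y : E, traceFunctional p d (algebraMap (ZMod p) E l * y ^ 2) (a, b) =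
      l * traceBilin σ (-a) b y y := by
    intro y
    by_cases hy : y = 0
    · subst hy
      have : d ≠ 0 := by
        rintro rfl
        simpa using hdF 0
      simp [traceFunctional_apply, this]
    · rw [traceFunctional_apply, traceBilin_apply, ← smul_eq_mul (l : ZMod p), ← map_smul,
        Algebra.smul_def, mul_pow _ _ d, hd, ← map_pow, hdF, map_mul, quadraticChar_sq_one' hy, hlE]
      congr 1
      dsimp only
      push_cast
      ring
  congr 4
  · simp only [h1]
  · simp only [h3, mul_eq_zero, hl0, false_or]

open Classical in
theorem traceFunctional_eq_smul_iff (hp2 : p ≠ 2) (hodd : Odd (Module.finrank (ZMod p) E))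
    {d : ℕ} (hdF : ∀ c : ZMod p, c ^ d = c) {x y : E} (hx : x ≠ 0) (hy : y ≠ 0) :
    (∃ c : ZMod p, traceFunctional p d x = c • traceFunctional p d y) ↔
      ∃ c : ZMod p, quadraticChar (ZMod p) c = 1 ∧ x = algebraMap (ZMod p) E c * y := by
  have hchar := ringChar_ne_two_of_algebra E hp2
  have hone : (-1 : E) ≠ 1 := Ring.neg_one_ne_one_of_char_ne_two hchar
  constructor
  · rintro ⟨c, hc⟩
    have e1 : ((quadraticChar E x : ℤ) : E) * x -
        algebraMap (ZMod p) E c * (((quadraticChar E y : ℤ) : E) * y) = 0 := by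
      refine eq_zero_of_trace_mul_eq_zero (F := ZMod p) fun a => ?_
      have := LinearMap.congr_fun hc (a, 0)
      simp only [traceFunctional_apply, LinearMap.smul_apply, zero_mul, add_zero] at this
      rw [mul_sub, map_sub, this, ← map_smul, Algebra.smul_def, sub_eq_zero]
      congr 1
      ring
    have e2 : x ^ d - algebraMap (ZMod p) E c * y ^ d = 0 := by
      refine eq_zero_of_trace_mul_eq_zero (F := ZMod p) fun a => ?_
      have := LinearMap.congr_fun hc (0, a)
      simp only [traceFunctional_apply, LinearMap.smul_apply, zero_mul, zero_add] at this
      rw [mul_sub, map_sub, this, ← map_smul, Algebra.smul_def, sub_eq_zero]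
      congr 1
      ring
    have hx2 : ((quadraticChar E x : ℤ) : E) ^ 2 = 1 := by
      exact_mod_cast congrArg (Int.cast (R := E)) (quadraticChar_sq_one hx)
    have hyd := pow_ne_zero d hy
    -- The a-component puts x/y in the prime field, equal to cχ(x)χ(y); the b-component, with ν^d =
    -- ν, forces x/y = c. A nonresidue would give χ(x) = -χ(y), contradicting the a-component.
    have hν : ∃ ν : ZMod p, algebraMap (ZMod p) E ν =
        algebraMap (ZMod p) E c * (quadraticChar E x : ℤ) * (quadraticChar E y : ℤ) :=
      ⟨c * (quadraticChar E x : ℤ) * (quadraticChar E y : ℤ), by push_cast; simp⟩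
    obtain ⟨ν, hν⟩ := hν
    have hxν : x = algebraMap (ZMod p) E ν * y := by
      rw [hν]
      linear_combination ((quadraticChar E x : ℤ) : E) * e1 - x * hx2
    have hνc : algebraMap (ZMod p) E ν = algebraMap (ZMod p) E c := by
      apply mul_right_cancel₀ hyd
      rw [hxν, mul_pow, ← map_pow, hdF] at e2
      linear_combination e2
    refine ⟨ν, ?_, hxν⟩
    have hν0 : ν ≠ 0 := by
      rintro rfl
      simp at hxν
      exact hx hxν
    rcases quadraticChar_dichotomy hν0 with h | h
    · exact h
    · exfalso
      have hxy : quadraticChar E x = - quadraticChar E y := by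
        rw [hxν, map_mul, quadraticChar_algebraMap hodd, h, neg_one_mul]
      rw [← hνc, mul_left_comm, ← hxν, hxy, ← sub_mul] at e1
      have h0 := (mul_eq_zero.mp e1).resolve_right hx
      rcases quadraticChar_dichotomy hy with h' | h' <;> rw [h'] at h0 <;> push_cast at h0
      · exact hone (by linear_combination h0)
      · exact hone (by linear_combination -h0)
  · rintro ⟨c, hc, rfl⟩
    refine ⟨c, LinearMap.ext fun ab => ?_⟩
    rw [LinearMap.smul_apply, traceFunctional_apply, traceFunctional_apply, ← map_smul,
      Algebra.smul_def, map_mul, quadraticChar_algebraMap hodd, hc, one_mul, mul_pow, ← map_pow, hdF]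
    congr 1
    ring

open Classical in
theorem two_mul_card_quadraticChar_eq_one (hp2 : p ≠ 2) :
    2 * (#{c : ZMod p | quadraticChar (ZMod p) c = 1} : ℤ) = p - 1 := by
  have hp := Fact.out (p := p.Prime)
  have hchar : ringChar (ZMod p) ≠ 2 := by rwa [ZMod.ringChar_zmod_n]
  have h1 : ∀ c ∈ univ.erase (0 : ZMod p), 2 * (if quadraticChar (ZMod p) c = 1 then (1 : ℤ) else 0) =
      1 + quadraticChar (ZMod p) c := by
    intro c hc
    rcases quadraticChar_dichotomy (ne_of_mem_erase hc) with h | h <;> rw [h] <;> norm_num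
  have hchi : ∑ t ∈ univ.erase (0 : ZMod p), quadraticChar (ZMod p) t = 0 := by
    rw [← quadraticChar_sum_zero hchar, ← Finset.add_sum_erase univ _ (mem_univ 0)]
    simp
  rw [Finset.natCast_card_filter, ← Finset.add_sum_erase univ _ (mem_univ 0), mul_add,
    Finset.mul_sum, Finset.sum_congr rfl h1, Finset.sum_add_distrib, hchi]
  rw [sum_const, card_erase_of_mem (mem_univ _), card_univ, ZMod.card, nsmul_eq_mul,
    Nat.cast_sub hp.one_le]
  simp

open Classical in
theorem sum_card_traceFunctional_zeros (d : ℕ) :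
    (p : ℤ) * ∑ ab : E × E, (#{x ∈ univ.erase (0 : E) | traceFunctional p d x ab = 0} : ℤ) =
      (Fintype.card E - 1) * Fintype.card E ^ 2 := by
  simp only [Finset.natCast_card_filter]
  rw [Finset.sum_comm, Finset.mul_sum]
  simp only [← Finset.natCast_card_filter]
  have : ∀ x ∈ univ.erase (0 : E), (p : ℤ) * (#{ab | traceFunctional p d x ab = 0} : ℤ) =
      Fintype.card E ^ 2 := by
    intro x hx
    have := card_filter_functional_eq_zero _ (traceFunctional_ne_zero (p := p) d (ne_of_mem_erase hx))
    rw [Fintype.card_prod, ← sq] at this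
    exact_mod_cast this
  rw [Finset.sum_congr rfl this, sum_const, card_erase_of_mem (mem_univ _), card_univ,
    nsmul_eq_mul, Nat.cast_sub Fintype.card_pos]
  simp

-- Expand the square over pairs (x, y). Each nonzero y has (p-1)/2 partners x with a proportional
-- functional, whose kernel is the same hyperplane; every other pair meets in codimension two.
open Classical in
theorem sum_sq_card_traceFunctional_zeros (hp2 : p ≠ 2)
    (hodd : Odd (Module.finrank (ZMod p) E)) {d : ℕ} (hdF : ∀ c : ZMod p, c ^ d = c) :
    2 * (p : ℤ) ^ 2 *
      ∑ ab : E × E, (#{x ∈ univ.erase (0 : E) | traceFunctional p d x ab = 0} : ℤ) ^ 2 =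
      (Fintype.card E - 1) *
        (2 * (Fintype.card E - 1) * Fintype.card E ^ 2 + (p - 1) ^ 2 * Fintype.card E ^ 2) := by
  simp only [Finset.natCast_card_filter, sq (∑ x ∈ univ.erase (0 : E), _), Finset.sum_mul_sum]
  rw [Finset.sum_comm]
  have hterm : ∀ y ∈ univ.erase (0 : E), ∀ x ∈ univ.erase (0 : E), (p : ℤ) ^ 2 *
      ∑ ab : E × E, ((if traceFunctional p d y ab = 0 then (1 : ℤ) else 0) *
        (if traceFunctional p d x ab = 0 then (1 : ℤ) else 0)) =
      Fintype.card E ^ 2 + (p - 1) * Fintype.card E ^ 2 *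
        if ∃ c : ZMod p, quadraticChar (ZMod p) c = 1 ∧ x = algebraMap (ZMod p) E c * y
        then 1 else 0 := by
    intro y hy x hx
    replace hx := ne_of_mem_erase hx
    replace hy := ne_of_mem_erase hy
    simp only [ite_zero_mul_ite_zero, mul_one, ← Finset.natCast_card_filter]
    split_ifs with h
    · obtain ⟨c, hc⟩ := (traceFunctional_eq_smul_iff hp2 hodd hdF hx hy).mpr h
      have h1 := card_filter_functional_eq_zero _ (traceFunctional_ne_zero (p := p) d hy)
      rw [Fintype.card_prod, ← sq] at h1
      have h2 : #{ab | traceFunctional p d y ab = 0 ∧ traceFunctional p d x ab = 0} =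
          #{ab | traceFunctional p d y ab = 0} := by
        congr 1
        ext ab
        simp +contextual [hc]
      rw [h2]
      have h1' : (p : ℤ) * #{ab | traceFunctional p d y ab = 0} = Fintype.card E ^ 2 := by
        exact_mod_cast h1
      linear_combination p * h1'
    · rw [← traceFunctional_eq_smul_iff hp2 hodd hdF hx hy] at h
      push Not at h
      have := card_filter_two_functionals _ _ (traceFunctional_ne_zero (p := p) d hy) h
      rw [Fintype.card_prod, ← sq] at this
      rw [mul_zero, add_zero]
      exact_mod_cast this
  have hcount : ∀ y ∈ univ.erase (0 : E), 2 * ∑ x ∈ univ.erase (0 : E),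
      (if ∃ c : ZMod p, quadraticChar (ZMod p) c = 1 ∧ x = algebraMap (ZMod p) E c * y
        then (1 : ℤ) else 0) = p - 1 := by
    intro y hy
    replace hy := ne_of_mem_erase hy
    rw [← Finset.natCast_card_filter, ← two_mul_card_quadraticChar_eq_one hp2]
    congr 2
    refine (Finset.card_bij (fun c _ => algebraMap (ZMod p) E c * y) ?_ ?_ ?_).symm
    · intro c hc
      simp only [mem_filter, mem_univ, true_and] at hc
      have hc0 : c ≠ 0 := by rintro rfl; simp at hc
      simp only [mem_filter, mem_erase, mem_univ, and_true]
      exact ⟨mul_ne_zero (by simpa using hc0) hy, c, hc, rfl⟩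
    · intro c _ c' _ h
      exact (algebraMap (ZMod p) E).injective (mul_right_cancel₀ hy h)
    · intro x hx
      obtain ⟨_, c, hc, rfl⟩ := mem_filter.mp hx
      exact ⟨c, by simpa using hc, rfl⟩
  have hE1 : (#(univ.erase (0 : E)) : ℤ) = Fintype.card E - 1 := by
    rw [card_erase_of_mem (mem_univ _), card_univ, Nat.cast_sub Fintype.card_pos]; simp
  have hinner : ∀ y ∈ univ.erase (0 : E), 2 * (p : ℤ) ^ 2 *
      ∑ ab : E × E, ∑ x ∈ univ.erase (0 : E),
        ((if traceFunctional p d y ab = 0 then (1 : ℤ) else 0) *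
        (if traceFunctional p d x ab = 0 then (1 : ℤ) else 0)) =
      2 * (Fintype.card E - 1) * Fintype.card E ^ 2 + (p - 1) ^ 2 * Fintype.card E ^ 2 := by
    intro y hy
    rw [Finset.sum_comm, mul_assoc, Finset.mul_sum, Finset.sum_congr rfl (hterm y hy),
      Finset.sum_add_distrib, ← Finset.mul_sum, sum_const, nsmul_eq_mul, hE1]
    linear_combination ((p : ℤ) - 1) * Fintype.card E ^ 2 * hcount y hy
  rw [Finset.mul_sum, Finset.sum_congr rfl hinner, sum_const, nsmul_eq_mul, hE1]

end Counting

/-! ### Polynomial description of cyclic codes -/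

section Codes

variable {F : Type*} [Field F] {n : ℕ}

theorem wordPoly_add (c c' : Fin n → F) : wordPoly (c + c') = wordPoly c + wordPoly c' := by
  simp only [wordPoly, ← Finset.sum_add_distrib]
  exact Finset.sum_congr rfl fun i _ => by rw [Pi.add_apply, C_add, add_mul]

theorem wordPoly_smul (a : F) (c : Fin n → F) : wordPoly (a • c) = C a * wordPoly c := by
  simp only [wordPoly, Finset.mul_sum]
  exact Finset.sum_congr rfl fun i _ => by rw [Pi.smul_apply, smul_eq_mul, C_mul, mul_assoc]

theorem wordPoly_coeff (c : Fin n → F) (i : Fin n) : (wordPoly c).coeff i = c i := by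
  rw [wordPoly, finsetSum_coeff, Finset.sum_eq_single i]
  · simp
  · intro j _ hj
    rw [coeff_C_mul, coeff_X_pow, if_neg (fun h => hj (Fin.ext h.symm)), mul_zero]
  · simp

theorem degree_wordPoly_lt (c : Fin n → F) : (wordPoly c).degree < n := by
  rw [wordPoly, Polynomial.degree_lt_iff_coeff_zero]
  intro j hj
  rw [finsetSum_coeff]
  refine Finset.sum_eq_zero fun i _ => ?_
  rw [coeff_C_mul, coeff_X_pow, if_neg (by have := i.2; omega), mul_zero]

theorem exists_wordPoly_eq {f : F[X]} (hf : f.degree < n) : ∃ c : Fin n → F, wordPoly c = f := by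
  refine ⟨fun i => f.coeff i, ?_⟩
  ext j
  by_cases hj : j < n
  · exact wordPoly_coeff (fun i : Fin n => f.coeff i) ⟨j, hj⟩
  · have hnj : (n : WithBot ℕ) ≤ j := by exact_mod_cast not_lt.mp hj
    rw [coeff_eq_zero_of_degree_lt ((degree_wordPoly_lt _).trans_le hnj),
      coeff_eq_zero_of_degree_lt (hf.trans_le hnj)]

theorem exists_wordClass_eq_mk (hn : n ≠ 0) (f : F[X]) :
    ∃ c : Fin n → F, wordClass c = Ideal.Quotient.mk (Ideal.span {(X ^ n - 1 : F[X])}) f := by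
  have hmon : (X ^ n - 1 : F[X]).Monic := by simpa using monic_X_pow_sub_C (1 : F) hn
  obtain ⟨c, hc⟩ := exists_wordPoly_eq (n := n) (f := f %ₘ (X ^ n - 1)) (by
    refine (degree_modByMonic_lt f hmon).trans_le ?_
    rw [← C_1, degree_X_pow_sub_C (Nat.pos_of_ne_zero hn)])
  refine ⟨c, ?_⟩
  rw [wordClass, hc, Ideal.Quotient.eq, Ideal.mem_span_singleton]
  exact ⟨-(f /ₘ (X ^ n - 1)), by linear_combination modByMonic_add_div f (X ^ n - 1)⟩

theorem mk_mem_span_mk_iff {g : F[X]} (hg : g ∣ X ^ n - 1) (f : F[X]) :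
    Ideal.Quotient.mk (Ideal.span {(X ^ n - 1 : F[X])}) f ∈
      Ideal.span {Ideal.Quotient.mk (Ideal.span {(X ^ n - 1 : F[X])}) g} ↔ g ∣ f := by
  rw [Ideal.mem_span_singleton]
  constructor
  · rintro ⟨r, hr⟩
    obtain ⟨r, rfl⟩ := Ideal.Quotient.mk_surjective r
    rw [← map_mul, Ideal.Quotient.eq, Ideal.mem_span_singleton] at hr
    have := (hg.trans hr).add (dvd_mul_right g r)
    rwa [sub_add_cancel] at this
  · exact fun h => map_dvd _ h

/-- The words `c` with `h · c ≡ 0` modulo `Xⁿ - 1`. -/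
noncomputable def parityCode (n : ℕ) (h : F[X]) : Submodule F (Fin n → F) where
  carrier := {c | X ^ n - 1 ∣ h * wordPoly c}
  add_mem' := fun {a b} ha hb => by
    rw [Set.mem_ofPred_eq, wordPoly_add, mul_add]
    exact dvd_add ha hb
  zero_mem' := by simp [wordPoly]
  smul_mem' := fun a c hc => by
    rw [Set.mem_ofPred_eq, wordPoly_smul, mul_left_comm]
    exact Dvd.dvd.mul_left hc _

theorem mem_parityCode {h : F[X]} {c : Fin n → F} :
    c ∈ parityCode n h ↔ X ^ n - 1 ∣ h * wordPoly c := Iff.rfl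

theorem mem_parityCode_iff_dvd {g h : F[X]} (h0 : h ≠ 0) (hgh : g * h = X ^ n - 1)
    {c : Fin n → F} : c ∈ parityCode n h ↔ g ∣ wordPoly c := by
  rw [mem_parityCode, ← hgh, mul_comm g h, mul_dvd_mul_iff_left h0]

/-- Minimality of degree is automatic: the class of any other generator g' lies in the code, so g
divides g'. -/
theorem isParityCheckPolynomial_iff (hn : n ≠ 0) {h : F[X]} (hmon : h.Monic)
    (hdvd : h ∣ X ^ n - 1) (K : Submodule F (Fin n → F)) :
    IsParityCheckPolynomial K h ↔ K = parityCode n h := by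
  have hXmon : (X ^ n - 1 : F[X]).Monic := by simpa using monic_X_pow_sub_C (1 : F) hn
  constructor
  · rintro ⟨g, ⟨-, hgen, -⟩, hgh⟩
    ext c
    rw [hgen c, mem_parityCode_iff_dvd hmon.ne_zero hgh, wordClass,
      mk_mem_span_mk_iff (Dvd.intro _ hgh)]
  · rintro rfl
    obtain ⟨g, hg⟩ := hdvd
    rw [mul_comm] at hg
    have hgmon : g.Monic := hmon.of_mul_monic_right (hg ▸ hXmon)
    have hgen : IsGeneratedBy (parityCode n h) g := fun c => by
      rw [mem_parityCode_iff_dvd hmon.ne_zero hg.symm, wordClass,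
        mk_mem_span_mk_iff (Dvd.intro _ hg.symm)]
    refine ⟨g, ⟨hgmon, hgen, fun g' hg' hgen' => ?_⟩, hg.symm⟩
    obtain ⟨c, hc⟩ := exists_wordClass_eq_mk hn g'
    have h1 : c ∈ parityCode n h := by
      rw [hgen' c, hc]
      exact Ideal.mem_span_singleton_self _
    rw [hgen c, hc, mk_mem_span_mk_iff (Dvd.intro _ hg.symm)] at h1
    exact natDegree_le_of_dvd h1 hg'.ne_zero

/-- Each codeword is g·u with deg u < deg h. -/
theorem card_parityCode_le [Finite F] (hn : n ≠ 0) {h : F[X]} (hdvd : h ∣ X ^ n - 1) :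
    Nat.card (parityCode n h) ≤ Nat.card F ^ h.natDegree := by
  have hXmon : (X ^ n - 1 : F[X]).Monic := by simpa using monic_X_pow_sub_C (1 : F) hn
  obtain ⟨g, hg⟩ := hdvd
  rw [mul_comm] at hg
  have h0 : h ≠ 0 := by rintro rfl; exact hXmon.ne_zero (by simp [hg])
  have hg0 : g ≠ 0 := by rintro rfl; exact hXmon.ne_zero (by simp [hg])
  have hdeg : g.natDegree + h.natDegree = n := by
    rw [← natDegree_mul hg0 h0, ← hg, ← C_1, natDegree_X_pow_sub_C]
  have hsub : (parityCode n h : Set (Fin n → F)) ⊆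
      Set.range fun (u : Fin h.natDegree → F) (i : Fin n) => (g * wordPoly u).coeff i := by
    intro c hc
    obtain ⟨u, hu⟩ := (mem_parityCode_iff_dvd h0 hg.symm).mp hc
    have hudeg : u.degree < h.natDegree := by
      by_cases hu0 : u = 0
      · rw [hu0, degree_zero]; exact WithBot.bot_lt_coe _
      have h1 := degree_wordPoly_lt c
      rw [hu, ← natDegree_lt_iff_degree_lt (mul_ne_zero hg0 hu0), natDegree_mul hg0 hu0] at h1
      rw [← natDegree_lt_iff_degree_lt hu0]
      omega
    obtain ⟨v, rfl⟩ := exists_wordPoly_eq hudeg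
    exact ⟨v, funext fun i => by simp only [← hu, wordPoly_coeff]⟩
  calc Nat.card (parityCode n h) ≤ Nat.card (Set.range fun (u : Fin h.natDegree → F) (i : Fin n) =>
        (g * wordPoly u).coeff i) := Nat.card_mono (Set.toFinite _) hsub
    _ ≤ Nat.card (Fin h.natDegree → F) := Finite.card_range_le _
    _ = Nat.card F ^ h.natDegree := by simp [Nat.card_fun]

theorem pow_finRotate {M : Type*} [Monoid M] {x : M} (hx : x ^ n = 1) (i : Fin n) :
    x ^ (finRotate n i : ℕ) = x ^ (i : ℕ) * x := by
  obtain _ | n := n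
  · exact i.elim0
  rw [← pow_succ]
  by_cases hi : i = Fin.last n
  · rw [hi, finRotate_last, Fin.val_last, hx, Fin.val_zero, pow_zero]
  · rw [coe_finRotate_of_ne_last hi]

variable {E : Type*} [Field E] [Algebra F E] [FiniteDimensional F E] [IsGalois F E]

/-- Over E the trace word is a combination of geometric series in τ(β)X. Each becomes a scalar
multiple of X^n - 1 after multiplication by X - τ(β)⁻¹, which divides h. -/
theorem trace_word_mem_parityCode {β : E} (hn : n ≠ 0) (hβ : β ^ n = 1) {h : F[X]}
    (hh : aeval β⁻¹ h = 0) (a : E) :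
    (fun i : Fin n => Algebra.trace F E (a * β ^ (i : ℕ))) ∈ parityCode n h := by
  have hmon : (X ^ n - 1 : F[X]).Monic := by simpa using monic_X_pow_sub_C (1 : F) hn
  have hβ0 : β ≠ 0 := by rintro rfl; simp [hn] at hβ
  rw [mem_parityCode, ← map_dvd_map (algebraMap F E) (algebraMap F E).injective hmon]
  have hmap : (wordPoly fun i : Fin n => Algebra.trace F E (a * β ^ (i : ℕ))).map (algebraMap F E) =
      ∑ τ : E ≃ₐ[F] E, C (τ a) * ∑ i ∈ range n, (C (τ β) * X) ^ i := by
    rw [wordPoly, Polynomial.map_sum]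
    simp only [Polynomial.map_mul, Polynomial.map_pow, map_C, map_X, trace_eq_sum_automorphisms,
      map_sum, Finset.sum_mul, Finset.mul_sum]
    rw [Finset.sum_comm]
    refine Finset.sum_congr rfl fun τ _ => ?_
    rw [Finset.sum_range]
    refine Finset.sum_congr rfl fun i _ => ?_
    rw [map_mul, map_pow, C_mul, C_pow, mul_pow, mul_assoc]
  rw [Polynomial.map_mul, hmap, Finset.mul_sum]
  refine Finset.dvd_sum fun τ _ => ?_
  rw [mul_left_comm]
  refine Dvd.dvd.mul_left ?_ _
  have hroot : (X - C (τ β)⁻¹) ∣ h.map (algebraMap F E) := by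
    rw [dvd_iff_isRoot, IsRoot, eval_map_algebraMap, ← map_inv₀, Polynomial.aeval_algHom_apply, hh,
      map_zero]
  obtain ⟨u, hu⟩ := hroot
  have hgeom := mul_geom_sum (C (τ β) * X) n
  have hfac : (C (τ β) * X - 1 : E[X]) = C (τ β) * (X - C (τ β)⁻¹) := by
    rw [mul_sub, ← C_mul, mul_inv_cancel₀ (by simpa using hβ0), C_1]
  have hX : (X ^ n - 1 : E[X]) = (C (τ β) * X) ^ n - 1 := by
    rw [mul_pow, ← C_pow, ← map_pow, hβ, map_one, C_1, one_mul]
  rw [Polynomial.map_sub, Polynomial.map_pow, map_X, Polynomial.map_one, hX, ← hgeom, hfac, hu]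
  refine ⟨C (τ β)⁻¹ * u, ?_⟩
  have : (C (τ β) * C (τ β)⁻¹ : E[X]) = 1 := by
    rw [← C_mul, mul_inv_cancel₀ (by simpa using hβ0), C_1]
  linear_combination -((X - C (τ β)⁻¹) * (∑ i ∈ range n, (C (τ β) * X) ^ i) * u) * this

end Codes

/-! ### Solving for the frequencies -/

section Moments

/-- The cardinality and two moments form a linear system for three frequencies. In the application
pP = p^m and H = p^((m-e)/2). -/
theorem card_of_moments {T : Type*} [Fintype T] [DecidableEq T] (t₀ : T) (Z : T → ℤ)
    {p P D H : ℤ} (hp : p ≠ 0) (hD : D ≠ 0) (hT : Fintype.card T = (p * P) ^ 2)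
    (h0 : Z t₀ = p * P - 1)
    (hZ : ∀ t ≠ t₀, Z t = P - 1 + D ∨ Z t = P - 1 ∨ Z t = P - 1 - D)
    (hDH : 2 * D * H = (p - 1) * P)
    (h1 : p * ∑ t, Z t = (p * P - 1) * (p * P) ^ 2)
    (h2 : 2 * p ^ 2 * ∑ t, Z t ^ 2 =
      (p * P - 1) * (2 * (p * P - 1) * (p * P) ^ 2 + (p - 1) ^ 2 * (p * P) ^ 2)) :
    (#{t ∈ univ.erase t₀ | Z t = P - 1 + D} : ℤ) = (H ^ 2 + H) * (p * P - 1) ∧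
    (#{t ∈ univ.erase t₀ | Z t = P - 1} : ℤ) = (p * P - 2 * H ^ 2 + 1) * (p * P - 1) ∧
    (#{t ∈ univ.erase t₀ | Z t = P - 1 - D} : ℤ) = (H ^ 2 - H) * (p * P - 1) := by
  set A := (#{t ∈ univ.erase t₀ | Z t = P - 1 + D} : ℤ) with hA
  set B := (#{t ∈ univ.erase t₀ | Z t = P - 1} : ℤ) with hB
  set C := (#{t ∈ univ.erase t₀ | Z t = P - 1 - D} : ℤ) with hC
  have hsum : ∀ f : ℤ → ℤ, ∑ t, f (Z t) =
      f (p * P - 1) + (A * f (P - 1 + D) + B * f (P - 1) + C * f (P - 1 - D)) := by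
    intro f
    have hterm : ∀ t ∈ univ.erase t₀, f (Z t) =
        (if Z t = P - 1 + D then 1 else 0) * f (P - 1 + D) +
        (if Z t = P - 1 then 1 else 0) * f (P - 1) +
        (if Z t = P - 1 - D then 1 else 0) * f (P - 1 - D) := by
      intro t ht
      rcases hZ t (ne_of_mem_erase ht) with h | h | h
      · rw [if_pos h, if_neg (by omega), if_neg (by omega), h]; ring
      · rw [if_neg (by omega), if_pos h, if_neg (by omega), h]; ring
      · rw [if_neg (by omega), if_neg (by omega), if_pos h, h]; ring
    rw [← Finset.add_sum_erase univ _ (mem_univ t₀), h0, Finset.sum_congr rfl hterm,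
      Finset.sum_add_distrib, Finset.sum_add_distrib, ← Finset.sum_mul, ← Finset.sum_mul,
      ← Finset.sum_mul, hA, hB, hC]
    simp only [Finset.natCast_card_filter]
  have e0 := hsum fun _ => 1
  have e1 := hsum fun z => z
  have e2 := hsum fun z => z ^ 2
  simp only [sum_const, card_univ, hT, nsmul_eq_mul, mul_one] at e0 e1 e2
  rw [e1] at h1
  rw [e2] at h2
  -- Centring at P - 1 eliminates B: the first moment gives A - C and the second gives A + C.
  have d1 : A - C = 2 * H * (p * P - 1) := by
    apply mul_left_cancel₀ (mul_ne_zero hp hD)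
    linear_combination h1 + p * (P - 1) * e0 - p * (p * P - 1) * hDH
  have d2 : A + C = 2 * H ^ 2 * (p * P - 1) := by
    apply mul_left_cancel₀ (mul_ne_zero (mul_ne_zero two_ne_zero (pow_ne_zero 2 hp)) (pow_ne_zero 2 hD))
    linear_combination h2 + 2 * p ^ 2 * (P - 1) ^ 2 * e0 - 4 * p ^ 2 * (P - 1) * D * d1
      - p ^ 2 * (p * P - 1) * (2 * D * H + (p - 1) * P) * hDH
      - 4 * p ^ 2 * (P - 1) * (p * P - 1) * hDH
  have d3 : A + B + C = (p * P) ^ 2 - 1 := by linear_combination -e0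
  refine ⟨by linarith, by linear_combination d3 - d2, by linarith⟩

end Moments

/-! ### Code invariants read off an encoding -/

section CodeOfEncoding

variable {F V : Type*} [Field F] [AddCommGroup V] [Module F V]
  {n : ℕ} {Φ : V →ₗ[F] (Fin n → F)}

theorem weightCount_range [DecidableEq F] [Fintype V] [DecidableEq V] (hΦ : Function.Injective Φ) {w : ℕ} (hw : w ≠ 0) :
    weightCount (LinearMap.range Φ) w = #{v ∈ univ.erase (0 : V) | hammingNorm (Φ v) = w} := by
  have : {c | c ∈ LinearMap.range Φ ∧ hammingNorm c = w} =
      Φ '' (({v ∈ univ.erase (0 : V) | hammingNorm (Φ v) = w} : Finset V) : Set V) := by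
    ext c
    constructor
    · rintro ⟨⟨v, rfl⟩, h⟩
      refine ⟨v, ?_, rfl⟩
      rw [mem_coe, mem_filter, mem_erase]
      refine ⟨⟨?_, mem_univ _⟩, h⟩
      rintro rfl
      rw [map_zero, hammingNorm_zero] at h
      exact hw h.symm
    · rintro ⟨v, hv, rfl⟩
      rw [mem_coe, mem_filter] at hv
      exact ⟨⟨v, rfl⟩, hv.2⟩
  rw [weightCount, this, Set.ncard_image_of_injective _ hΦ, Set.ncard_coe_finset]

theorem weightCount_zero [DecidableEq F] (K : Submodule F (Fin n → F)) : weightCount K 0 = 1 := by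
  rw [weightCount, Set.ncard_eq_one]
  refine ⟨0, ?_⟩
  ext c
  simp only [hammingNorm_eq_zero, Set.mem_ofPred_eq, Set.mem_singleton_iff]
  exact ⟨fun h => h.2, fun h => ⟨h ▸ K.zero_mem, h⟩⟩

theorem hasMinDistance_range [DecidableEq F] (hΦ : Function.Injective Φ) {d : ℕ}
    (hle : ∀ v ≠ 0, d ≤ hammingNorm (Φ v)) (hex : ∃ v ≠ 0, hammingNorm (Φ v) = d) :
    HasMinDistance (LinearMap.range Φ) d := by
  constructor
  · obtain ⟨v, hv, h⟩ := hex
    refine ⟨Φ v, ⟨v, rfl⟩, 0, Submodule.zero_mem _, ?_, ?_⟩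
    · rwa [Ne, map_eq_zero_iff Φ hΦ]
    · rw [hammingDist_zero_right, h]
  · rintro w ⟨_, ⟨x, rfl⟩, _, ⟨y, rfl⟩, hxy, rfl⟩
    rw [hammingDist_comm, hammingDist_eq_hammingNorm, ← map_neg, ← map_add]
    refine hle _ fun h => hxy ?_
    rw [neg_add_eq_zero.mp h]

theorem isThreeWeight_range [DecidableEq F] {w₁ w₂ w₃ : ℕ} (hw₁ : w₁ ≠ 0) (h₁₂ : w₁ < w₂)
    (h₂₃ : w₂ < w₃)
    (hle : ∀ v ≠ 0, hammingNorm (Φ v) = w₁ ∨ hammingNorm (Φ v) = w₂ ∨ hammingNorm (Φ v) = w₃)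
    (h₁ : ∃ v, hammingNorm (Φ v) = w₁) (h₂ : ∃ v, hammingNorm (Φ v) = w₂)
    (h₃ : ∃ v, hammingNorm (Φ v) = w₃) :
    IsThreeWeight (LinearMap.range Φ) := by
  have : {w : ℕ | w ≠ 0 ∧ ∃ c ∈ LinearMap.range Φ, hammingNorm c = w} = {w₁, w₂, w₃} := by
    ext w
    constructor
    · rintro ⟨hw, _, ⟨v, rfl⟩, rfl⟩
      exact hle v fun h => hw (by rw [h, map_zero, hammingNorm_zero])
    · rintro (rfl | rfl | rfl)
      · obtain ⟨v, h⟩ := h₁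
        exact ⟨hw₁, _, ⟨v, rfl⟩, h⟩
      · obtain ⟨v, h⟩ := h₂
        exact ⟨by omega, _, ⟨v, rfl⟩, h⟩
      · obtain ⟨v, h⟩ := h₃
        exact ⟨by omega, _, ⟨v, rfl⟩, h⟩
  rw [IsThreeWeight, this, Set.ncard_eq_three]
  exact ⟨w₁, w₂, w₃, by omega, by omega, by omega, rfl⟩

theorem isCyclicCode_range_of_shift (S : V → V)
    (hS : ∀ v i, Φ (S v) (finRotate n i) = Φ v i) : IsCyclicCode (LinearMap.range Φ) := by
  rintro _ ⟨v, rfl⟩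
  refine ⟨S v, funext fun i => ?_⟩
  have := hS v ((finRotate n).symm i)
  rwa [Equiv.apply_symm_apply] at this

end CodeOfEncoding

/-! ### The trace encoding -/

section Encoding

variable {p : ℕ} [Fact p.Prime] {E : Type*} [Field E] [Algebra (ZMod p) E]

/-- The encoding `(a, b) ↦ (Tr (a α ^ i + b β ^ i))ᵢ`. -/
noncomputable def traceEncoding (p : ℕ) [Fact p.Prime] [Algebra (ZMod p) E] (n : ℕ) (α β : E) :
    (E × E) →ₗ[ZMod p] (Fin n → ZMod p) where
  toFun ab i := Algebra.trace (ZMod p) E (ab.1 * α ^ (i : ℕ) + ab.2 * β ^ (i : ℕ))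
  map_add' u v := by
    funext i
    rw [Pi.add_apply, ← map_add, Prod.fst_add, Prod.snd_add]; congr 1; ring
  map_smul' c u := by
    funext i
    rw [RingHom.id_apply, Pi.smul_apply, ← map_smul, Prod.smul_fst, Prod.smul_snd]
    congr 1
    simp only [Algebra.smul_def]; ring

theorem traceEncoding_apply {n : ℕ} (α β : E) (ab : E × E) (i : Fin n) :
    traceEncoding p n α β ab i =
      Algebra.trace (ZMod p) E (ab.1 * α ^ (i : ℕ) + ab.2 * β ^ (i : ℕ)) := rfl

theorem isCyclicCode_range_traceEncoding {n : ℕ} {α β : E} (hα : α ^ n = 1) (hβ : β ^ n = 1)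
    (hα0 : α ≠ 0) (hβ0 : β ≠ 0) :
    IsCyclicCode (LinearMap.range (traceEncoding p n α β)) := by
  refine isCyclicCode_range_of_shift (fun ab => (ab.1 * α⁻¹, ab.2 * β⁻¹)) fun ab i => ?_
  rw [traceEncoding_apply, traceEncoding_apply, pow_finRotate hα, pow_finRotate hβ]
  congr 1
  field_simp

theorem range_traceEncoding_le [Finite E] {n : ℕ} (hn : n ≠ 0) {α β : E} (hα : α ^ n = 1) (hβ : β ^ n = 1)
    {h : (ZMod p)[X]} (h1 : aeval α⁻¹ h = 0) (h2 : aeval β⁻¹ h = 0) :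
    LinearMap.range (traceEncoding p n α β) ≤ parityCode n h := by
  rintro _ ⟨ab, rfl⟩
  convert Submodule.add_mem _ (trace_word_mem_parityCode hn hα h1 ab.1)
    (trace_word_mem_parityCode hn hβ h2 ab.2) using 1
  funext i
  rw [traceEncoding_apply, Pi.add_apply, ← map_add]

open Classical in
theorem card_traceEncoding_zeros [Fintype E] {n : ℕ} (hn : n = Fintype.card E - 1)
    {π : E} (hπ : IsPrimitiveRoot π n) (h2 : ringChar E ≠ 2) (d : ℕ) (ab : E × E) :
    #{i | traceEncoding p n (-π) (π ^ d) ab i = 0} =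
      #{x ∈ univ.erase (0 : E) | traceFunctional p d x ab = 0} := by
  subst hn
  have hcard : 1 < Fintype.card E := Fintype.one_lt_card
  have hodd := FiniteField.odd_card_of_char_ne_two h2
  have hπ0 : π ≠ 0 := hπ.ne_zero (by omega)
  -- This is where the sign in -π becomes the quadratic character: (-π)^i = χ(π^i)π^i.
  have hχ : quadraticChar E π = -1 := by
    rw [quadraticChar_neg_one_iff_not_isSquare, FiniteField.isSquare_iff h2 hπ0]
    exact hπ.pow_ne_one_of_pos_of_lt (by omega) (by omega)
  have heq : ∀ i : Fin (Fintype.card E - 1), traceEncoding p (Fintype.card E - 1) (-π) (π ^ d) ab i =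
      traceFunctional p d (π ^ (i : ℕ)) ab := by
    intro i
    rw [traceEncoding_apply, traceFunctional_apply, map_pow, hχ, neg_pow π, ← pow_mul, ← pow_mul,
      mul_comm d]
    push_cast
    rfl
  simp only [heq]
  refine Finset.card_bij (fun i _ => π ^ (i : ℕ)) ?_ ?_ ?_
  · intro i hi
    rw [mem_filter] at hi ⊢
    exact ⟨mem_erase.mpr ⟨pow_ne_zero _ hπ0, mem_univ _⟩, hi.2⟩
  · intro i _ j _ h
    exact Fin.ext (hπ.pow_inj i.2 j.2 h)
  · intro x hx
    rw [mem_filter] at hx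
    have : NeZero (Fintype.card E - 1) := ⟨by omega⟩
    obtain ⟨i, hi, rfl⟩ := hπ.eq_pow_of_pow_eq_one
      (FiniteField.pow_card_sub_one_eq_one x (ne_of_mem_erase hx.1))
    exact ⟨⟨i, hi⟩, by rw [mem_filter]; exact ⟨mem_univ _, hx.2⟩, rfl⟩

theorem hammingNorm_add_card_zeros {n : ℕ} {F : Type*} [Field F] [DecidableEq F] (c : Fin n → F) :
    hammingNorm c + #{i | c i = 0} = n := by
  have := Finset.card_filter_add_card_filter_not (s := (univ : Finset (Fin n))) fun i => c i = 0
  rw [card_univ, Fintype.card_fin] at this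
  rw [hammingNorm, add_comm]
  convert this

end Encoding

/-- With k = 2l, the exponent is 1 modulo p^l - 1, since (p^{2l}+1)/2 = (p^l-1)(p^l+1)/2 + 1. -/
theorem zmod_pow_half_eq_self {p : ℕ} [Fact p.Prime] (hp2 : p ≠ 2) {k : ℕ}
    (hk : Even k) (c : ZMod p) : c ^ ((p ^ k + 1) / 2) = c := by
  obtain ⟨l, rfl⟩ := hk
  have hodd : Odd p := (Fact.out (p := p.Prime)).odd_of_ne_two hp2
  obtain ⟨j, hj⟩ := hodd.pow (n := l)
  have hd : (p ^ (l + l) + 1) / 2 = (2 * j) * (j + 1) + 1 := by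
    rw [pow_add, hj]
    refine Nat.div_eq_of_eq_mul_left two_pos ?_
    ring
  rw [hd]
  by_cases hc : c = 0
  · rw [hc, zero_pow (by omega)]
  have h1 : c ^ (2 * j) = 1 := by
    apply mul_right_cancel₀ hc
    rw [← pow_succ, ← hj, ZMod.pow_card_pow, one_mul]
  rw [pow_succ, pow_mul, h1, one_pow, one_mul]

/-! ### Distribution of the number of zeros -/

section Distribution

variable {p : ℕ} [Fact p.Prime] {E : Type*} [Field E] [Fintype E] [Algebra (ZMod p) E]

theorem exists_frobenius_pow_algEquiv (p : ℕ) [Fact p.Prime] [Algebra (ZMod p) E] (k : ℕ) :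
    ∃ σ : E ≃ₐ[ZMod p] E, ∀ x, σ x = x ^ p ^ k := by
  refine ⟨FiniteField.frobeniusAlgEquivOfAlgebraic (ZMod p) E ^ k, fun x => ?_⟩
  rw [AlgEquiv.coe_pow, FiniteField.coe_frobeniusAlgEquivOfAlgebraic_iterate, ZMod.card]

open Classical in
theorem card_traceFunctional_zeros (hp2 : p ≠ 2) {m k e : ℕ} (hE : Fintype.card E = p ^ m)
    (hm : Odd m) (he : Odd e) (hgcd : e = Nat.gcd m k) (hk : Even k) {ab : E × E} (hab : ab ≠ 0) :
    let Z : ℤ := #{x ∈ univ.erase (0 : E) | traceFunctional p ((p ^ k + 1) / 2) x ab = 0}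
    let P : ℤ := p ^ (m - 1)
    let D : ℤ := ((p - 1) / 2 * p ^ ((m + e - 2) / 2) : ℕ)
    Z = P - 1 + D ∨ Z = P - 1 ∨ Z = P - 1 - D := by
  intro Z P D
  obtain ⟨a, b⟩ := ab
  have hp := Fact.out (p := p.Prime)
  have hfin : Module.finrank (ZMod p) E = m := by
    have := FiniteField.pow_finrank_eq_card p E
    rw [hE] at this
    exact Nat.pow_right_injective hp.two_le this
  obtain ⟨σ, hσ⟩ := exists_frobenius_pow_algEquiv (E := E) p k
  have hpodd : Odd p := hp.odd_of_ne_two hp2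
  have hd2 : 2 * ((p ^ k + 1) / 2) = p ^ k + 1 := by
    obtain ⟨j, hj⟩ := hpodd.pow (n := k)
    omega
  have hd : ∀ y : E, (y ^ 2) ^ ((p ^ k + 1) / 2) = y * σ y := by
    intro y
    rw [← pow_mul, hd2, hσ, pow_succ, mul_comm]
  have h1 := two_mul_card_traceFunctional_zeros hp2 (hfin ▸ hm) σ hd
    (zmod_pow_half_eq_self hp2 hk) a b
  obtain ⟨ε, hε, h2⟩ := card_zeros_traceBilin_add hp2 hE hm he hgcd σ hσ (a := a) (b := b) (by
    by_contra! h
    exact hab (Prod.ext h.1 h.2))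
  rw [h2] at h1
  -- The form counts include x = 0, which is not a position of the word.
  have hZ : (#{x : E | traceFunctional p ((p ^ k + 1) / 2) x (a, b) = 0} : ℤ) = Z + 1 := by
    have h0 : (0 : E) ∈ ({x : E | traceFunctional p ((p ^ k + 1) / 2) x (a, b) = 0} : Finset E) := by
      have : (p ^ k + 1) / 2 ≠ 0 := by omega
      simp [traceFunctional_apply, this]
    rw [← Finset.card_erase_add_one h0, ← Finset.filter_erase]
    push_cast
    rfl
  have hD : 2 * D = (p - 1) * p ^ ((m + e - 2) / 2) := by
    obtain ⟨j, hj⟩ := hpodd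
    simp only [D]
    rw [show (p - 1) / 2 = j by omega, hj]
    push_cast
    ring
  rw [hZ] at h1
  have hZ' : Z = P - 1 + ε * D := by
    apply mul_left_cancel₀ (two_ne_zero (α := ℤ))
    linear_combination h1 - ε * hD
  rcases hε with rfl | rfl | rfl
  · right; left; linarith
  · left; linarith
  · right; right; linarith

open Classical in
theorem card_traceFunctional_zeros_distribution (hp2 : p ≠ 2) {m k e : ℕ}
    (hE : Fintype.card E = p ^ m)
    (hm : Odd m) (he : Odd e) (hgcd : e = Nat.gcd m k) (hk : Even k) :
    let Z : E × E → ℤ := fun ab =>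
      #{x ∈ univ.erase (0 : E) | traceFunctional p ((p ^ k + 1) / 2) x ab = 0}
    let P : ℤ := p ^ (m - 1)
    let D : ℤ := ((p - 1) / 2 * p ^ ((m + e - 2) / 2) : ℕ)
    (#{ab ∈ univ.erase (0 : E × E) | Z ab = P - 1 + D} : ℤ) =
      (p ^ (m - e) + p ^ ((m - e) / 2)) * (p ^ m - 1) ∧
    (#{ab ∈ univ.erase (0 : E × E) | Z ab = P - 1} : ℤ) =
      (p ^ m - 2 * p ^ (m - e) + 1) * (p ^ m - 1) ∧
    (#{ab ∈ univ.erase (0 : E × E) | Z ab = P - 1 - D} : ℤ) =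
      (p ^ (m - e) - p ^ ((m - e) / 2)) * (p ^ m - 1) := by
  intro Z P D
  have hp := Fact.out (p := p.Prime)
  have hfin : Module.finrank (ZMod p) E = m := by
    have := FiniteField.pow_finrank_eq_card p E
    rw [hE] at this
    exact Nat.pow_right_injective hp.two_le this
  have hpP : (p : ℤ) * P = p ^ m := by
    rw [← pow_succ', Nat.sub_add_cancel hm.pos]
  have hp3 : 3 ≤ p := by have := hp.two_le; omega
  have hem : e ≤ m := hgcd ▸ Nat.gcd_le_left k hm.pos
  have hpodd : Odd p := hp.odd_of_ne_two hp2
  have hDpos : 0 < (p - 1) / 2 * p ^ ((m + e - 2) / 2) :=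
    Nat.mul_pos (by omega) (pow_pos hp.pos _)
  have hD : 2 * D = (p - 1) * p ^ ((m + e - 2) / 2) := by
    obtain ⟨j, hj⟩ := hpodd
    simp only [D]
    rw [show (p - 1) / 2 = j by omega, hj]
    push_cast
    ring
  have hH : ((p : ℤ) ^ ((m - e) / 2)) ^ 2 = p ^ (m - e) := by
    rw [← pow_mul]
    congr 1
    obtain ⟨i, hi⟩ := hm
    obtain ⟨j, hj⟩ := he
    omega
  have hexp : (m + e - 2) / 2 + (m - e) / 2 = m - 1 := by
    obtain ⟨i, hi⟩ := hm
    obtain ⟨j, hj⟩ := he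
    omega
  have h1 := sum_card_traceFunctional_zeros (p := p) (E := E) ((p ^ k + 1) / 2)
  have h2 := sum_sq_card_traceFunctional_zeros (p := p) (E := E) hp2 (hfin ▸ hm)
    (zmod_pow_half_eq_self hp2 hk)
  rw [hE, Nat.cast_pow, ← hpP] at h1 h2
  rw [← hH, ← hpP]
  refine card_of_moments 0 Z (by exact_mod_cast hp.ne_zero) (by simp only [D]; exact_mod_cast hDpos.ne')
    ?_ ?_ (fun ab hab => card_traceFunctional_zeros hp2 hE hm he hgcd hk hab) ?_ h1 h2
  · rw [hpP, Fintype.card_prod, hE]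
    push_cast
    ring
  · simp only [Z, map_zero, hpP]
    rw [Finset.filter_true_of_mem (by simp), card_erase_of_mem (mem_univ _), card_univ, hE,
      Nat.cast_sub (Nat.one_le_pow _ _ hp.pos)]
    push_cast
    rfl
  · rw [hD, mul_assoc, ← pow_add, hexp]

end Distribution

/-! ### Identification of the code and conclusion -/

theorem parityCheck_dvd {F E : Type*} [Field F] [Field E] [Algebra F E] {n : ℕ} {α β : E}
    (hα : α ^ n = 1) (hβ : β ^ n = 1) (hαi : IsIntegral F α) (hβi : IsIntegral F β)
    (hne : minpoly F α ≠ minpoly F β) :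
    minpoly F α * minpoly F β ∣ X ^ n - 1 := by
  refine IsCoprime.mul_dvd ?_ (minpoly.dvd F α (by simp [hα])) (minpoly.dvd F β (by simp [hβ]))
  refine (minpoly.irreducible hαi).coprime_iff_not_dvd.mpr fun h => hne ?_
  exact eq_of_monic_of_associated (minpoly.monic hαi) (minpoly.monic hβi)
    ((minpoly.irreducible hαi).associated_of_dvd (minpoly.irreducible hβi) h)

/-- If the trace encoding is injective, its image is the code with parity-check polynomial the
product of the two minimal polynomials. -/
theorem isParityCheckPolynomial_iff_eq_range {p : ℕ} [Fact p.Prime] {E : Type*} [Field E]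
    [Fintype E] [Algebra (ZMod p) E] {n : ℕ} (hn : n ≠ 0) {α β : E} (hα : α ^ n = 1)
    (hβ : β ^ n = 1) (hinj : Function.Injective (traceEncoding p n α β))
    (K : Submodule (ZMod p) (Fin n → ZMod p)) :
    IsParityCheckPolynomial K (minpoly (ZMod p) α⁻¹ * minpoly (ZMod p) β⁻¹) ↔
      K = LinearMap.range (traceEncoding p n α β) := by
  have hp := Fact.out (p := p.Prime)
  set h₁ := minpoly (ZMod p) α⁻¹ with hh₁
  set h₂ := minpoly (ZMod p) β⁻¹ with hh₂
  have hαi : IsIntegral (ZMod p) α⁻¹ := Algebra.IsIntegral.isIntegral _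
  have hβi : IsIntegral (ZMod p) β⁻¹ := Algebra.IsIntegral.isIntegral _
  have hα' : α⁻¹ ^ n = 1 := by rw [inv_pow, hα, inv_one]
  have hβ' : β⁻¹ ^ n = 1 := by rw [inv_pow, hβ, inv_one]
  have hdeg₁ : h₁.natDegree ≤ Module.finrank (ZMod p) E := minpoly.natDegree_le _
  have hdeg₂ : h₂.natDegree ≤ Module.finrank (ZMod p) E := minpoly.natDegree_le _
  have hrange : Nat.card (LinearMap.range (traceEncoding p n α β)) =
      p ^ (2 * Module.finrank (ZMod p) E) := by
    rw [Nat.card_congr (LinearEquiv.ofInjective _ hinj).symm.toEquiv, Nat.card_prod,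
      Nat.card_eq_fintype_card, ← FiniteField.pow_finrank_eq_card p E, ← pow_add, two_mul]
  -- Were they equal, the image, of size |E|², would lie in a code of size at most |E|.
  have hne : h₁ ≠ h₂ := by
    intro h
    have hle := range_traceEncoding_le (p := p) hn hα hβ (h := h₁) (minpoly.aeval _ _)
      (by rw [h]; exact minpoly.aeval _ _)
    have h1 := Nat.card_mono (Set.toFinite _) hle
    have h2 := card_parityCode_le hn (h := h₁) (minpoly.dvd _ _ (by simp [hα']))
    have h3 := hrange ▸ h1.trans h2
    rw [Nat.card_zmod, Nat.pow_le_pow_iff_right hp.one_lt] at h3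
    have : 0 < Module.finrank (ZMod p) E := Module.finrank_pos
    omega
  have hdvd := parityCheck_dvd hα' hβ' hαi hβi hne
  rw [isParityCheckPolynomial_iff hn ((minpoly.monic hαi).mul (minpoly.monic hβi)) hdvd]
  have hle := range_traceEncoding_le (p := p) hn hα hβ (h := h₁ * h₂)
    (by rw [map_mul, minpoly.aeval, zero_mul]) (by rw [map_mul, minpoly.aeval, mul_zero])
  have heq : LinearMap.range (traceEncoding p n α β) = parityCode n (h₁ * h₂) := by
    refine SetLike.coe_injective (Set.eq_of_subset_of_ncard_le hle ?_ (Set.toFinite _))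
    refine (card_parityCode_le hn hdvd).trans (le_of_le_of_eq ?_ hrange.symm)
    rw [Nat.card_zmod, natDegree_mul (minpoly.ne_zero hαi) (minpoly.ne_zero hβi)]
    exact Nat.pow_le_pow_right hp.pos ((Nat.add_le_add hdeg₁ hdeg₂).trans_eq (two_mul _).symm)
  rw [heq]

end CyclicCodes

theorem theorem3 (p : ℕ) [Fact p.Prime] (hp : p ≠ 2)
    (m k e : ℕ) (hm : 0 < m) (hk : 0 < k) (he : e = Nat.gcd m k)
    (hs : Odd (m / e)) (hs3 : 3 ≤ m / e) (hk_even : Even k) (he_odd : Odd e)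
    (E : Type*) [Field E] [Finite E] [Algebra (ZMod p) E] (hE : Nat.card E = p ^ m)
    (π : E) (hπ : IsPrimitiveRoot π (p ^ m - 1))
    (h₁ h₂ : Polynomial (ZMod p))
    (hh₁ : h₁ = minpoly (ZMod p) ((-π)⁻¹))
    (hh₂ : h₂ = minpoly (ZMod p) ((π ^ ((p ^ k + 1) / 2))⁻¹)) :
    (∃! K : Submodule (ZMod p) (Fin (p ^ m - 1) → ZMod p),
      CyclicCodes.IsParityCheckPolynomial K (h₁ * h₂)) ∧
    ∀ K : Submodule (ZMod p) (Fin (p ^ m - 1) → ZMod p),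
      CyclicCodes.IsParityCheckPolynomial K (h₁ * h₂) →
      CyclicCodes.IsCyclicCode K ∧
      CyclicCodes.IsThreeWeight K ∧
      CyclicCodes.HasParameters K (2 * m)
        (p ^ m - p ^ (m - 1) - (p - 1) / 2 * p ^ ((m + e - 2) / 2)) ∧
      CyclicCodes.weightCount K 0 = 1 ∧
      CyclicCodes.weightCount K
          (p ^ m - p ^ (m - 1) - (p - 1) / 2 * p ^ ((m + e - 2) / 2)) =
        (p ^ (m - e) + p ^ ((m - e) / 2)) * (p ^ m - 1) ∧
      CyclicCodes.weightCount K (p ^ m - p ^ (m - 1)) =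
        (p ^ m - 2 * p ^ (m - e) + 1) * (p ^ m - 1) ∧
      CyclicCodes.weightCount K
          (p ^ m - p ^ (m - 1) + (p - 1) / 2 * p ^ ((m + e - 2) / 2)) =
        (p ^ (m - e) - p ^ ((m - e) / 2)) * (p ^ m - 1) ∧
      ∀ w : ℕ, w ≠ 0 →
        w ≠ p ^ m - p ^ (m - 1) - (p - 1) / 2 * p ^ ((m + e - 2) / 2) →
        w ≠ p ^ m - p ^ (m - 1) →
        w ≠ p ^ m - p ^ (m - 1) + (p - 1) / 2 * p ^ ((m + e - 2) / 2) →
        CyclicCodes.weightCount K w = 0 := by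
  classical
  have : Fintype E := Fintype.ofFinite E
  have hcardE : Fintype.card E = p ^ m := by rw [← Nat.card_eq_fintype_card, hE]
  have hpp := Fact.out (p := p.Prime)
  have hp3 : 3 ≤ p := by have := hpp.two_le; omega
  have hpodd : Odd p := hpp.odd_of_ne_two hp
  have hdvd : e ∣ m := he ▸ Nat.gcd_dvd_left m k
  have hm_eq : e * (m / e) = m := Nat.mul_div_cancel' hdvd
  have hm_odd : Odd m := hm_eq ▸ he_odd.mul hs
  have he_pos : 0 < e := he_odd.pos
  have hem : e * 3 ≤ m := hm_eq ▸ Nat.mul_le_mul_left e hs3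
  have hP : p ^ m = p * p ^ (m - 1) := by rw [← pow_succ', Nat.sub_add_cancel hm]
  have hn0 : p ^ m - 1 ≠ 0 := by
    have := Nat.one_lt_pow hm.ne' hpp.one_lt
    omega
  have hn_even : Even (p ^ m - 1) := Nat.Odd.sub_odd hpodd.pow odd_one
  set d := (p ^ k + 1) / 2 with hd
  set D := (p - 1) / 2 * p ^ ((m + e - 2) / 2) with hD
  have hDpos : 0 < D := Nat.mul_pos (by omega) (pow_pos hpp.pos _)
  have hDlt : D < p ^ m - p ^ (m - 1) := by
    have h1 : p ^ ((m + e - 2) / 2) ≤ p ^ (m - 1) := Nat.pow_le_pow_right hpp.pos (by omega)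
    have h2 : p ^ m - p ^ (m - 1) = (p - 1) * p ^ (m - 1) := by rw [hP, Nat.sub_mul, one_mul]
    rw [h2]
    calc D ≤ (p - 1) / 2 * p ^ (m - 1) := Nat.mul_le_mul_left _ h1
      _ < (p - 1) * p ^ (m - 1) := Nat.mul_lt_mul_of_pos_right (by omega) (pow_pos hpp.pos _)
  have hPle : p ^ (m - 1) ≤ p ^ m := Nat.pow_le_pow_right hpp.pos (by omega)
  set W := p ^ m - p ^ (m - 1) with hW
  set Φ := CyclicCodes.traceEncoding p (p ^ m - 1) (-π) (π ^ d) with hΦ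
  have hZ : ∀ ab, (hammingNorm (Φ ab) : ℤ) = p ^ m - 1 -
      (Finset.card {x ∈ Finset.univ.erase (0 : E) | CyclicCodes.traceFunctional p d x ab = 0}) := by
    intro ab
    have h := CyclicCodes.hammingNorm_add_card_zeros (Φ ab)
    rw [CyclicCodes.card_traceEncoding_zeros (by rw [hcardE]) hπ
      (CyclicCodes.ringChar_ne_two_of_algebra E hp)] at h
    have h' : ((p ^ m - 1 : ℕ) : ℤ) = p ^ m - 1 := by
      rw [Nat.cast_sub (Nat.one_le_pow _ _ hpp.pos)]
      push_cast
      rfl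
    have h'' : (hammingNorm (Φ ab) : ℤ) +
        (Finset.card {x ∈ Finset.univ.erase (0 : E) | CyclicCodes.traceFunctional p d x ab = 0}) =
          ((p ^ m - 1 : ℕ) : ℤ) := by exact_mod_cast h
    linarith
  have hWZ : (W : ℤ) = p ^ m - p ^ (m - 1) := by
    rw [hW, Nat.cast_sub hPle]
    push_cast
    rfl
  have hWD : ((W - D : ℕ) : ℤ) = W - D := Nat.cast_sub hDlt.le
  have hweights : ∀ ab ≠ 0, hammingNorm (Φ ab) = W - D ∨ hammingNorm (Φ ab) = W ∨
      hammingNorm (Φ ab) = W + D := by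
    intro ab hab
    have h := hZ ab
    rcases CyclicCodes.card_traceFunctional_zeros hp hcardE hm_odd he_odd he hk_even hab
      with h' | h' | h' <;> rw [← hd] at h' <;> rw [h'] at h
    · left; omega
    · right; left; omega
    · right; right; omega
  -- All three weights are positive because 0 < D < W.
  have hinj : Function.Injective Φ := by
    rw [injective_iff_map_eq_zero]
    intro ab h0
    by_contra hab
    have := hweights ab hab
    rw [h0, hammingNorm_zero] at this
    omega
  have hα : (-π) ^ (p ^ m - 1) = 1 := by rw [hn_even.neg_pow, hπ.pow_eq_one]
  have hβ : (π ^ d) ^ (p ^ m - 1) = 1 := by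
    rw [← pow_mul, mul_comm, pow_mul, hπ.pow_eq_one, one_pow]
  have hiff := CyclicCodes.isParityCheckPolynomial_iff_eq_range hn0 hα hβ hinj
  rw [← hh₁, ← hh₂] at hiff
  simp only [hiff]
  refine ⟨⟨_, rfl, fun _ h => h⟩, ?_⟩
  rintro _ rfl
  obtain ⟨c₁, c₂, c₃⟩ := CyclicCodes.card_traceFunctional_zeros_distribution (E := E) hp hcardE
    hm_odd he_odd he hk_even
  rw [← hd, ← hD] at c₁ c₃
  rw [← hd] at c₂
  dsimp only at c₁ c₂ c₃
  -- This bound and the next make the truncated subtractions in the frequencies genuine; strictness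
  -- here makes the third frequency nonzero, so that weight occurs.
  have hH : p ^ ((m - e) / 2) < p ^ (m - e) := Nat.pow_lt_pow_right hpp.one_lt (by omega)
  have hH2 : 2 * p ^ (m - e) ≤ p ^ m := by
    calc 2 * p ^ (m - e) ≤ p ^ e * p ^ (m - e) :=
          Nat.mul_le_mul_right _ ((hpp.two_le).trans (Nat.le_self_pow he_pos.ne' p))
      _ = p ^ m := by rw [← pow_add]; congr 1; omega
  have hn1 : ((p ^ m - 1 : ℕ) : ℤ) = p ^ m - 1 := by
    rw [Nat.cast_sub (Nat.one_le_pow _ _ hpp.pos)]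
    push_cast
    rfl
  have w₁ : CyclicCodes.weightCount (LinearMap.range Φ) (W - D) =
      (p ^ (m - e) + p ^ ((m - e) / 2)) * (p ^ m - 1) := by
    rw [CyclicCodes.weightCount_range hinj (by omega)]
    zify
    rw [hn1, ← c₁]
    congr 2
    refine Finset.filter_congr fun ab _ => ?_
    have := hZ ab
    omega
  have w₂ : CyclicCodes.weightCount (LinearMap.range Φ) W =
      (p ^ m - 2 * p ^ (m - e) + 1) * (p ^ m - 1) := by
    rw [CyclicCodes.weightCount_range hinj (by omega)]
    zify [hH2]
    rw [hn1, ← c₂]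
    congr 2
    refine Finset.filter_congr fun ab _ => ?_
    have := hZ ab
    omega
  have w₃ : CyclicCodes.weightCount (LinearMap.range Φ) (W + D) =
      (p ^ (m - e) - p ^ ((m - e) / 2)) * (p ^ m - 1) := by
    rw [CyclicCodes.weightCount_range hinj (by omega)]
    zify [hH.le]
    rw [hn1, ← c₃]
    congr 2
    refine Finset.filter_congr fun ab _ => ?_
    have := hZ ab
    omega
  have hex : ∀ w : ℕ, w ≠ 0 → CyclicCodes.weightCount (LinearMap.range Φ) w ≠ 0 →
      ∃ ab ≠ 0, hammingNorm (Φ ab) = w := by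
    intro w hw h
    rw [CyclicCodes.weightCount_range hinj hw] at h
    obtain ⟨ab, hab⟩ := Finset.card_ne_zero.mp h
    rw [Finset.mem_filter, Finset.mem_erase] at hab
    exact ⟨ab, hab.1.1, hab.2⟩
  have hex₁ := hex (W - D) (by omega) (by rw [w₁]; exact mul_ne_zero (by omega) hn0)
  have hex₂ := hex W (by omega) (by rw [w₂]; exact mul_ne_zero (by omega) hn0)
  have hex₃ := hex (W + D) (by omega) (by rw [w₃]; exact mul_ne_zero (by omega) hn0)
  have hπ0 : π ≠ 0 := hπ.ne_zero hn0
  refine ⟨CyclicCodes.isCyclicCode_range_traceEncoding hα hβ (neg_ne_zero.mpr hπ0)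
      (pow_ne_zero _ hπ0), ?_, ⟨?_, ?_⟩, CyclicCodes.weightCount_zero _, w₁, w₂, w₃, ?_⟩
  · exact CyclicCodes.isThreeWeight_range (by omega) (w₁ := W - D) (w₂ := W) (w₃ := W + D)
      (by omega) (by omega) hweights (hex₁.imp fun _ h => h.2) (hex₂.imp fun _ h => h.2)
      (hex₃.imp fun _ h => h.2)
  · have hfin : Module.finrank (ZMod p) E = m := by
      have := FiniteField.pow_finrank_eq_card p E
      rw [hcardE] at this
      exact Nat.pow_right_injective hpp.two_le this
    rw [LinearMap.finrank_range_of_inj hinj, Module.finrank_prod, hfin, two_mul]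
  · refine CyclicCodes.hasMinDistance_range hinj (fun ab hab => ?_) hex₁
    have := hweights ab hab
    omega
  · intro w hw hw₁ hw₂ hw₃
    rw [CyclicCodes.weightCount_range hinj hw, Finset.card_eq_zero,
      Finset.filter_eq_empty_iff]
    intro ab hab h
    have := hweights ab (Finset.ne_of_mem_erase hab)
    omega
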